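/- **Theorem B.** *Conventions.* Machines are multi-tape Turing machines with a read-only input tape, deterministic or nondeterministic; a computation may halt with answer "yes", "no", or without an answer. The decision on an input is "yes" if some computation halts with "yes", and "no" if all computations terminate and all answer "no". A complexity class $\mathcal C$ is given by a mode (deterministic or nondeterministic) and, for time or space or both, a collection of positive nondecreasing functions $f:\mathbb N\to\mathbb N$ that contains with $f$ also $n\mapsto Cf(Cn+C)+C$ for every integer $C\ge 1$. A language $\mathcal D\subseteq X^*$ is in $\mathcal C$ if some machine of the given mode terminates with the correct decision on all inputs $w$, all its computations using, of each controlled resource, at most $f(|w|)$ units for some $f$ in the corresponding collection. A set $S\subseteq X^*$ is *generic* if the proportion $\rho_n(S)$ of words in $S$ among all words of length at most $n$ tends to $1$, and *strongly generic* if moreover $1-\rho_n(S)\le c\,\sigma^n$ for all $n\ge 1$, with some $c>0$ and $0\le\sigma<1$. The language $\mathcal D$ is *(strongly) generically in $\mathcal C$* if there are a (strongly) generic set $S$ and a machine of the given mode, all of whose definite decisions are correct, which on all inputs $w\in S$ terminates with a decision within bounds of $\mathcal C$ as above. For a group $G$, a subgroup $H$ and a finite generating family $A=(a_1,\dots,a_k)$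 of $G$, the membership problem for $H$ with respect to $A$ is the set of words over the $2k$ letters $A\cup A^{-1}$ that represent elements of $H$. The membership problem for $H$ in $G$ is in $\mathcal C$, or is (strongly) generically in $\mathcal C$, if this holds with respect to every finite generating family $A$ of $G$. The Schreier coset graph $\Gamma(G,H,A)$ has the cosets $Hg$ as vertices and an edge from $Hg$ to $Hgx$ for every letter $x\in A\cup A^{-1}$; it is *amenable* if $\frac1{2k}\limsup_{n\to\infty} b_n^{1/n}=1$, where $b_n$ is the number of paths of length $n$ from $H$ to $H$ in it. *Statement.* Let $G$ be a finitely generated group, let $H\le G_1\le G$ with $[G:G_1]<\infty$, and let $\phi:G_1\to\overline G$ be an epimorphism such that $\phi(H)$ is contained in a subgroup $\overline K\le\overline G$ of infinite index. Let $\mathcal C$ be a complexity class such that the membership problem for $\overline K$ in $\overline G$ is in $\mathcal C$. Then the membership problem for $H$ in $G$ is generically in $\mathcal C$. Moreover, if $\Gamma(\overline G,\overline K,B)$ is non-amenable for some finite generating family $B$ of $\overline G$, then it is so for every such $B$, and the membership problem for $H$ in $G$ is strongly generically in $\mathcal C$. -/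

import Mathlib

open Filter Topology

namespace GenericCase

/-! ### Multi-tape Turing machines -/

/-- What the input head can scan: the left end marker, a letter of the input word, or the right
end marker. -/
inductive InputSymbol (X : Type) : Type
  | left : InputSymbol X
  | letter (x : X) : InputSymbol X
  | right : InputSymbol X

/-- Head movements. -/
inductive Move : Type
  | left : Move
  | stay : Move
  | right : Move

/-- One instruction of a machine with state set `Q`, tape alphabet `Γ` and `k` work tapes. -/
structure Action (Q Γ : Type) (k : ℕ) : Type where
  next : Q
  inputMove : Move
  write : Fin k → Γ
  move : Fin k → Move

/-- A (possibly nondeterministic) Turing machine over the input alphabet `X`, with a two-way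
read-only input tape and `k` read-write work tapes, each infinite to the right.
A configuration in which no instruction applies is halting; the answer is then read off the
state: yes (`some true`), no (`some false`), or no definite decision (`none`). -/
structure Machine (X : Type) : Type 1 where
  Q : Type
  finiteQ : Finite Q
  Γ : Type
  finiteΓ : Finite Γ
  k : ℕ
  start : Q
  blank : Γ
  trans : Q → InputSymbol X → (Fin k → Γ) → Set (Action Q Γ k)
  answer : Q → Option Bool

namespace Machine

variable {X : Type}

/-- Configurations. Position `0` of the input tape is the left end marker, positions
`1, …, |w|` hold the letters of the input word `w`, position `|w| + 1` is the right end marker.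
`used i` is the number of cells of the `i`-th work tape visited so far. -/
structure Config (M : Machine X) : Type where
  state : M.Q
  inputPos : ℕ
  tape : Fin M.k → ℕ → M.Γ
  pos : Fin M.k → ℕ
  used : Fin M.k → ℕ

/-- The symbol at position `p` of the input tape. -/
def inputAt (w : List X) : ℕ → InputSymbol X
  | 0 => InputSymbol.left
  | p + 1 => match w[p]? with
    | some x => InputSymbol.letter x
    | none => InputSymbol.right

/-- The new position of a work-tape head (at the left end of the tape it cannot move left). -/
def moveHead : Move → ℕ → ℕ
  | Move.left, p => p - 1
  | Move.stay, p => p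
  | Move.right, p => p + 1

/-- The new position of the input head, which cannot leave `0, …, |w| + 1`. -/
def moveInput (w : List X) (d : Move) (p : ℕ) : ℕ :=
  min (moveHead d p) (w.length + 1)

/-- The initial configuration: all heads at the left ends, work tapes blank. -/
def init (M : Machine X) : M.Config where
  state := M.start
  inputPos := 0
  tape := fun _ _ => M.blank
  pos := fun _ => 0
  used := fun _ => 1

/-- The instructions that apply in the configuration `c` on input `w`. -/
def enabled (M : Machine X) (w : List X) (c : M.Config) : Set (Action M.Q M.Γ M.k) :=
  M.trans c.state (inputAt w c.inputPos) (fun i => c.tape i (c.pos i))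

/-- The configuration that results from executing an instruction. -/
def exec (M : Machine X) (w : List X) (c : M.Config) (a : Action M.Q M.Γ M.k) : M.Config where
  state := a.next
  inputPos := moveInput w a.inputMove c.inputPos
  tape := fun i => Function.update (c.tape i) (c.pos i) (a.write i)
  pos := fun i => moveHead (a.move i) (c.pos i)
  used := fun i => max (c.used i) (moveHead (a.move i) (c.pos i) + 1)

/-- `M.ReachIn w n c`: some computation of `M` on input `w` is in configuration `c` after exactly
`n` steps. -/
inductive ReachIn (M : Machine X) (w : List X) : ℕ → M.Config → Prop
  | init : ReachIn M w 0 M.init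
  | step {n : ℕ} {c : M.Config} {a : Action M.Q M.Γ M.k} :
      ReachIn M w n c → a ∈ M.enabled w c → ReachIn M w (n + 1) (M.exec w c a)

/-- `c` is a halting configuration of some computation on input `w`. -/
def HaltsIn (M : Machine X) (w : List X) (c : M.Config) : Prop :=
  (∃ n, M.ReachIn w n c) ∧ M.enabled w c = ∅

/-- Every computation on input `w` makes at most `t` steps. -/
def TimeBound (M : Machine X) (w : List X) (t : ℕ) : Prop :=
  ∀ n c, M.ReachIn w n c → n ≤ t

/-- Every computation on input `w` visits at most `s` cells of the work tapes altogether. -/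
def SpaceBound (M : Machine X) (w : List X) (s : ℕ) : Prop :=
  ∀ n c, M.ReachIn w n c → ∑ i, c.used i ≤ s

/-- All computations on input `w` terminate. -/
def Terminates (M : Machine X) (w : List X) : Prop :=
  ∃ t, M.TimeBound w t

/-- The decision "yes": some computation on input `w` halts with answer yes. -/
def Accepts (M : Machine X) (w : List X) : Prop :=
  ∃ c, M.HaltsIn w c ∧ M.answer c.state = some true

/-- The decision "no": all computations on input `w` terminate, and all with answer no. -/
def Rejects (M : Machine X) (w : List X) : Prop :=
  M.Terminates w ∧ ∀ c, M.HaltsIn w c → M.answer c.state = some false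

/-- In every situation at most one instruction applies. -/
def Deterministic (M : Machine X) : Prop :=
  ∀ q x g, (M.trans q x g).Subsingleton

end Machine

/-! ### Complexity classes -/

/-- Modes of computation. -/
inductive Mode : Type
  | deterministic : Mode
  | nondeterministic : Mode

/-- A family of bounds for one resource: positive nondecreasing functions, closed under
`f ↦ C f(Cn + C) + C` for all integers `C ≥ 1`. (No constructibility of the bounds is demanded,
so that the families of proper complexity functions with this closure property are included.) -/
structure IsBoundFamily (F : Set (ℕ → ℕ)) : Prop where
  mono : ∀ f ∈ F, Monotone f
  pos : ∀ f ∈ F, ∀ n, 0 < f n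
  closed : ∀ f ∈ F, ∀ C : ℕ, 1 ≤ C → (fun n => C * f (C * n + C) + C) ∈ F

/-- A complexity class: a mode of computation, and a family of bounds for each controlled
resource (`none` means that the resource is not controlled). -/
structure ComplexityClass : Type where
  mode : Mode
  time : Option (Set (ℕ → ℕ))
  space : Option (Set (ℕ → ℕ))
  controlled : time.isSome ∨ space.isSome
  time_bounds : ∀ F ∈ time, IsBoundFamily F
  space_bounds : ∀ F ∈ space, IsBoundFamily F

namespace ComplexityClass

variable {X : Type}

/-- `M` is a machine of the mode of `C`. -/
def AllowsMode (C : ComplexityClass) (M : Machine X) : Prop :=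
  C.mode = Mode.deterministic → M.Deterministic

/-- On every input from `S` the machine `M` terminates with a definite decision within the
complexity bound `C`. -/
def DecidesOn (C : ComplexityClass) (M : Machine X) (S : Set (List X)) : Prop :=
  (∀ w ∈ S, M.Terminates w ∧ (M.Accepts w ∨ M.Rejects w)) ∧
  (∀ F ∈ C.time, ∃ f ∈ F, ∀ w ∈ S, M.TimeBound w (f w.length)) ∧
  (∀ F ∈ C.space, ∃ f ∈ F, ∀ w ∈ S, M.SpaceBound w (f w.length))

end ComplexityClass

/-- `M` is a correct partial algorithm for `D`: every definite decision it reaches is correct. -/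
def CorrectFor {X : Type} (M : Machine X) (D : Set (List X)) : Prop :=
  ∀ w, (M.Accepts w → w ∈ D) ∧ (M.Rejects w → w ∉ D)

/-- The language `D` is in the complexity class `C`. -/
def InClass {X : Type} (C : ComplexityClass) (D : Set (List X)) : Prop :=
  ∃ M : Machine X, C.AllowsMode M ∧ CorrectFor M D ∧ C.DecidesOn M Set.univ

/-! ### Asymptotic density and generic-case complexity -/

/-- The proportion of words of length at most `n` that belong to `S`. -/
noncomputable def density {X : Type} (S : Set (List X)) (n : ℕ) : ℝ :=
  ((S ∩ {w | w.length ≤ n}).ncard : ℝ) / (({w | w.length ≤ n} : Set (List X)).ncard : ℝ)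

/-- Generic sets of words. -/
def Generic {X : Type} (S : Set (List X)) : Prop :=
  Tendsto (density S) atTop (𝓝 1)

/-- Strongly generic sets of words: the density tends to `1` exponentially fast. -/
def StronglyGeneric {X : Type} (S : Set (List X)) : Prop :=
  Generic S ∧ ∃ σ C : ℝ, 0 ≤ σ ∧ σ < 1 ∧ 0 < C ∧ ∀ n : ℕ, 1 ≤ n → 1 - density S n ≤ C * σ ^ n

/-- `D` is in `Gen(C)`. -/
def InGen {X : Type} (C : ComplexityClass) (D : Set (List X)) : Prop :=
  ∃ M : Machine X, C.AllowsMode M ∧ CorrectFor M D ∧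
    ∃ S : Set (List X), Generic S ∧ C.DecidesOn M S

/-- `D` is in `SGen(C)`. -/
def InSGen {X : Type} (C : ComplexityClass) (D : Set (List X)) : Prop :=
  ∃ M : Machine X, C.AllowsMode M ∧ CorrectFor M D ∧
    ∃ S : Set (List X), StronglyGeneric S ∧ C.DecidesOn M S

/-! ### The membership problem -/

section Groups

variable {G : Type*} [Group G] {k : ℕ}

/-- The family `a` generates the group `G`. -/
def Generates (a : Fin k → G) : Prop :=
  Subgroup.closure (Set.range a) = ⊤

/-- The element of `G` represented by a letter of `A ∪ A⁻¹`; the letters are `(i, true)` for `aᵢ`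
and `(i, false)` for `aᵢ⁻¹`. -/
def letterVal (a : Fin k → G) (x : Fin k × Bool) : G :=
  if x.2 then a x.1 else (a x.1)⁻¹

/-- The element of `G` represented by a word. -/
def wordVal (a : Fin k → G) (w : List (Fin k × Bool)) : G :=
  (w.map (letterVal a)).prod

/-- The membership problem for `H` with respect to the generators `a`. -/
def MP (H : Subgroup G) (a : Fin k → G) : Set (List (Fin k × Bool)) :=
  {w | wordVal a w ∈ H}

/-- The membership problem for `H` in `G` is in the class `C`. -/
def MembershipIn (C : ComplexityClass) (H : Subgroup G) : Prop :=
  ∀ (k : ℕ) (a : Fin k → G), Generates a → InClass C (MP H a)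

/-- The membership problem for `H` in `G` has generic-case complexity in `C`. -/
def MembershipGenericallyIn (C : ComplexityClass) (H : Subgroup G) : Prop :=
  ∀ (k : ℕ) (a : Fin k → G), Generates a → InGen C (MP H a)

/-- The membership problem for `H` in `G` has generic-case complexity strongly in `C`. -/
def MembershipStronglyGenericallyIn (C : ComplexityClass) (H : Subgroup G) : Prop :=
  ∀ (k : ℕ) (a : Fin k → G), Generates a → InSGen C (MP H a)

/-! ### Schreier coset graphs -/

/-- The vertices of the Schreier coset graph: the right cosets `Hg`. -/
abbrev Coset (H : Subgroup G) : Type _ := Quotient (QuotientGroup.rightRel H)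

/-- Right multiplication `Hg ↦ Hgx` of cosets. -/
def Coset.mulRight {H : Subgroup G} (v : Coset H) (x : G) : Coset H :=
  Quotient.map' (s₂ := QuotientGroup.rightRel H) (fun g => g * x) (by
    intro g g' h
    rw [QuotientGroup.rightRel_apply] at h ⊢
    simpa [mul_assoc] using h) v

/-- The Schreier coset graph `Γ(G, H, a)` has exactly one edge with origin `v` for each letter `x`,
and it ends at `vx`. So a path with origin `v` is given by the sequence of labels of its
edges; this is the terminal vertex of that path. -/
def pathEnd (H : Subgroup G) (a : Fin k → G) (v : Coset H) (p : List (Fin k × Bool)) : Coset H :=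
  p.foldl (fun u x => u.mulRight (letterVal a x)) v

/-- The number of paths of length `n` in `Γ(G, H, a)` from the base vertex `H1` to itself. -/
noncomputable def closedPaths (H : Subgroup G) (a : Fin k → G) (n : ℕ) : ℕ :=
  {p : List (Fin k × Bool) | p.length = n ∧
    pathEnd H a (Quotient.mk'' 1) p = (Quotient.mk'' 1 : Coset H)}.ncard

/-- The spectral radius `ν = (1/d) limsup (bₙ)^(1/n)` of the `d`-regular graph `Γ(G, H, a)`, where
`d = 2k` and `bₙ` is the number of closed paths of length `n` at the base vertex. -/
noncomputable def spectralRadius (H : Subgroup G) (a : Fin k → G) : ℝ :=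
  limsup (fun n : ℕ => (closedPaths H a n : ℝ) ^ (1 / (n : ℝ))) atTop / (2 * k)

/-- The Schreier coset graph `Γ(G, H, a)` is amenable. -/
def SchreierAmenable (H : Subgroup G) (a : Fin k → G) : Prop :=
  spectralRadius H a = 1

end Groups

end GenericCase

namespace GenericCase

/-!
Rewriting a word along the cosets of `G₁` is done by a reversible finite transducer, so a machine
for `K` can be run on the rewritten word without using more resources. Its answer "no" is correct
for `H`, and it answers "no" unless the word sends one of finitely many cosets of the preimage `L`
of `K` to a prescribed coset. The proportion of such words of length `n` is a matrix coefficient of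
`T ^ n`, where `T` is the transition operator of the random walk on `G ⧸ L`.

On an infinite transitive `G`-set no nonzero square summable `f` satisfies `T (T f) = f`, so by the
mean ergodic theorem these coefficients tend to `0`; they do so exponentially fast if `‖T‖ < 1`. By
Kesten's criterion, a coset graph is non-amenable exactly if its transition operator has norm less
than `1`. This is a spectral gap of the permutation representation, which does not depend on the
generators, and it passes from `Gbar ⧸ K` to `G ⧸ L`, a finite union of copies of `Gbar ⧸ K`.
-/

/-- A letter-to-letter transducer: a finite automaton that outputs one letter of `Y` for every
letter of `X` it reads. Every letter permutes the states, so that a simulating machine can also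
move its input head to the left. -/
structure Transducer (X Y : Type) : Type 1 where
  S : Type
  finiteS : Finite S
  start : S
  step : X → Equiv.Perm S
  out : S → X → Y

namespace Transducer

variable {X Y Q Γ : Type} {k : ℕ} (T : Transducer X Y)

/-- The state reached from `s` by reading a word. -/
def run (s : T.S) (w : List X) : T.S := w.foldl (fun t x => T.step x t) s

/-- The output produced from the state `s` on a word. -/
def output : T.S → List X → List Y
  | _, [] => []
  | s, x :: w => T.out s x :: output (T.step x s) w

@[simp] lemma length_output (s : T.S) (w : List X) : (T.output s w).length = w.length := by
  induction w generalizing s with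
  | nil => rfl
  | cons x w ih => simp [output, ih]

lemma getElem?_output (s : T.S) (w : List X) (p : ℕ) :
    (T.output s w)[p]? = w[p]?.map (T.out (T.run s (w.take p))) := by
  induction w generalizing s p with
  | nil => simp [output]
  | cons x w ih => cases p <;> simp [output, run, ih]

/-- The state of the transducer before it reads position `p` of the input tape, whose end markers
it ignores. -/
def stateAt (w : List X) (p : ℕ) : T.S := T.run T.start (w.take (p - 1))

/-- The output symbol for an input symbol read in the state `s`. -/
def symbol (s : T.S) : InputSymbol X → InputSymbol Y
  | .left => .left
  | .letter x => .letter (T.out s x)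
  | .right => .right

/-- The effect of an input symbol on the states. -/
def stepSymbol : InputSymbol X → Equiv.Perm T.S
  | .letter x => T.step x
  | _ => 1

/-- The state before the scanned symbol `y`, recovered from a stored state. A simulating machine
stores the state before `y` (`Sum.inl`) or, when it has just moved left and does not know `y` yet,
the state after `y` (`Sum.inr`). -/
def before : T.S ⊕ T.S → InputSymbol X → T.S
  | .inl s, _ => s
  | .inr s, y => (T.stepSymbol y).symm s

/-- What to store after a move of the input head away from the symbol `y`, where `s` is the state
before `y`. -/
def update (s : T.S) (y : InputSymbol X) : Move → T.S ⊕ T.S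
  | .left => .inr s
  | .stay => .inl s
  | .right => .inl (T.stepSymbol y s)

lemma symbol_stateAt (w : List X) (p : ℕ) :
    T.symbol (T.stateAt w p) (Machine.inputAt w p) = Machine.inputAt (T.output T.start w) p := by
  cases p with
  | zero => rfl
  | succ p =>
    simp only [stateAt, Machine.inputAt, T.getElem?_output, Nat.add_sub_cancel]
    cases w[p]? <;> rfl

lemma stateAt_succ (w : List X) (p : ℕ) :
    T.stateAt w (p + 1) = T.stepSymbol (Machine.inputAt w p) (T.stateAt w p) := by
  cases p with
  | zero => rfl
  | succ p =>
    simp only [stateAt, run, Machine.inputAt, Nat.add_sub_cancel, List.take_add_one (i := p),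
      List.foldl_append]
    cases w[p]? <;> rfl

lemma inputAt_min (w : List X) (p : ℕ) :
    Machine.inputAt w (min p (w.length + 1)) = Machine.inputAt w p := by
  rcases le_total p (w.length + 1) with h | h
  · rw [min_eq_left h]
  · obtain ⟨q, rfl⟩ := Nat.exists_eq_add_of_le' ((Nat.le_add_left 1 _).trans h)
    simp [min_eq_right h, Machine.inputAt, List.getElem?_eq_none (Nat.le_of_succ_le_succ h)]

lemma stateAt_min (w : List X) (p : ℕ) :
    T.stateAt w (min p (w.length + 1)) = T.stateAt w p := by
  rw [stateAt, stateAt, ← Nat.sub_min_sub_right, Nat.add_sub_cancel, ← List.take_eq_take_min]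

lemma before_update (w : List X) (p : ℕ) (d : Move) :
    T.before (T.update (T.stateAt w p) (Machine.inputAt w p) d)
        (Machine.inputAt w (Machine.moveInput w d p)) =
      T.stateAt w (Machine.moveInput w d p) := by
  rw [Machine.moveInput, inputAt_min, stateAt_min]
  cases d with
  | stay => rfl
  | right => exact (T.stateAt_succ w p).symm
  | left =>
    cases p with
    | zero => rfl
    | succ p => exact (Equiv.symm_apply_eq _).2 (T.stateAt_succ w p)

/-- The instruction of a simulating machine that corresponds to the instruction `α` of the
simulated machine, when `y` is scanned and `s` is the state before `y`. -/
def liftAction (s : T.S) (y : InputSymbol X) (α : Action Q Γ k) :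
    Action (Q × (T.S ⊕ T.S)) Γ k where
  next := (α.next, T.update s y α.inputMove)
  inputMove := α.inputMove
  write := α.write
  move := α.move

end Transducer

namespace Machine

variable {X Y : Type}

/-- The machine that simulates `M` step by step on the output of the transducer `T`. It keeps the
answer "no" and withholds every other answer. -/
abbrev pullback (M : Machine Y) (T : Transducer X Y) : Machine X where
  Q := M.Q × (T.S ⊕ T.S)
  finiteQ := by
    have := M.finiteQ
    have := T.finiteS
    infer_instance
  Γ := M.Γ
  finiteΓ := M.finiteΓ
  k := M.k
  start := (M.start, .inl T.start)
  blank := M.blank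
  trans := fun q y g =>
    T.liftAction (T.before q.2 y) y '' M.trans q.1 (T.symbol (T.before q.2 y) y) g
  answer := fun q => if M.answer q.1 = some false then some false else none

lemma Deterministic.pullback {M : Machine Y} (h : M.Deterministic) (T : Transducer X Y) :
    (M.pullback T).Deterministic :=
  fun _ _ _ => (h _ _ _).image _

/-- The configuration of `M` simulated by a configuration of `M.pullback T`. -/
def simulated (M : Machine Y) (T : Transducer X Y) (c : (M.pullback T).Config) : M.Config where
  state := c.state.1
  inputPos := c.inputPos
  tape := c.tape
  pos := c.pos
  used := c.used

/-- The transducer state stored in the configuration `c` is the correct one for the input `w`. -/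
def Tracks (M : Machine Y) (T : Transducer X Y) (w : List X) (c : (M.pullback T).Config) : Prop :=
  T.before c.state.2 (inputAt w c.inputPos) = T.stateAt w c.inputPos

variable {M : Machine Y} {T : Transducer X Y} {w : List X}

lemma Tracks.enabled_pullback {c : (M.pullback T).Config} (hc : Tracks M T w c) :
    (M.pullback T).enabled w c =
      T.liftAction (T.stateAt w c.inputPos) (inputAt w c.inputPos) ''
        M.enabled (T.output T.start w) (simulated M T c) := by
  change T.liftAction _ _ '' M.trans _ (T.symbol (T.before _ _) _) _ = _
  rw [show T.before c.state.2 _ = _ from hc, T.symbol_stateAt]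
  rfl

lemma simulated_exec (c : (M.pullback T).Config) (s : T.S) (y : InputSymbol X)
    (α : Action M.Q M.Γ M.k) :
    simulated M T ((M.pullback T).exec w c (T.liftAction s y α)) =
      M.exec (T.output T.start w) (simulated M T c) α := by
  simp only [simulated, exec, moveInput, Transducer.length_output]
  rfl

lemma ReachIn.tracks_and_simulated {n : ℕ} {c : (M.pullback T).Config}
    (h : (M.pullback T).ReachIn w n c) :
    Tracks M T w c ∧ M.ReachIn (T.output T.start w) n (simulated M T c) := by
  induction h with
  | init => exact ⟨rfl, .init⟩
  | step _ ha ih =>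
    rw [ih.1.enabled_pullback] at ha
    obtain ⟨α, hα, rfl⟩ := ha
    exact ⟨T.before_update w _ α.inputMove, simulated_exec _ _ _ α ▸ ih.2.step hα⟩

lemma ReachIn.exists_simulated {n : ℕ} {c : M.Config} (h : M.ReachIn (T.output T.start w) n c) :
    ∃ c', (M.pullback T).ReachIn w n c' ∧ simulated M T c' = c := by
  induction h with
  | init => exact ⟨_, .init, rfl⟩
  | @step n c α _ hα ih =>
    obtain ⟨c', hc', rfl⟩ := ih
    have hmem := Set.mem_image_of_mem
      (T.liftAction (T.stateAt w c'.inputPos) (inputAt w c'.inputPos)) hα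
    rw [← hc'.tracks_and_simulated.1.enabled_pullback] at hmem
    exact ⟨_, hc'.step hmem, simulated_exec c' _ _ α⟩

lemma timeBound_pullback_iff {t : ℕ} :
    (M.pullback T).TimeBound w t ↔ M.TimeBound (T.output T.start w) t := by
  refine ⟨fun h n c hc => ?_, fun h n c hc => h n _ hc.tracks_and_simulated.2⟩
  obtain ⟨c', hc', -⟩ := hc.exists_simulated
  exact h n c' hc'

lemma SpaceBound.pullback {s : ℕ} (h : M.SpaceBound (T.output T.start w) s) :
    (M.pullback T).SpaceBound w s :=
  fun n _ hc => h n _ hc.tracks_and_simulated.2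

lemma HaltsIn.simulated {c : (M.pullback T).Config} (h : (M.pullback T).HaltsIn w c) :
    M.HaltsIn (T.output T.start w) (simulated M T c) := by
  obtain ⟨⟨n, hn⟩, h0⟩ := h
  obtain ⟨htracks, hreach⟩ := hn.tracks_and_simulated
  rw [htracks.enabled_pullback, Set.image_eq_empty] at h0
  exact ⟨⟨n, hreach⟩, h0⟩

lemma HaltsIn.exists_simulated {c : M.Config} (h : M.HaltsIn (T.output T.start w) c) :
    ∃ c', (M.pullback T).HaltsIn w c' ∧ Machine.simulated M T c' = c := by
  obtain ⟨⟨n, hn⟩, h0⟩ := h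
  obtain ⟨c', hc', rfl⟩ := hn.exists_simulated
  refine ⟨c', ⟨⟨n, hc'⟩, ?_⟩, rfl⟩
  rw [hc'.tracks_and_simulated.1.enabled_pullback, h0, Set.image_empty]

lemma answer_pullback_eq_false_iff {q : (M.pullback T).Q} :
    (M.pullback T).answer q = some false ↔ M.answer q.1 = some false := by
  change (if _ then some false else none) = some false ↔ _
  split_ifs with h <;> simp [h]

lemma not_accepts_pullback : ¬ (M.pullback T).Accepts w := by
  rintro ⟨c, -, h⟩
  change (if _ then some false else none) = some true at h
  split_ifs at h
  simp at h

lemma rejects_pullback_iff : (M.pullback T).Rejects w ↔ M.Rejects (T.output T.start w) := by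
  refine and_congr (exists_congr fun _ => timeBound_pullback_iff)
    ⟨fun h c hc => ?_, fun h c hc => answer_pullback_eq_false_iff.2 (h _ hc.simulated)⟩
  obtain ⟨c', hc', rfl⟩ := hc.exists_simulated
  exact answer_pullback_eq_false_iff.1 (h c' hc')

end Machine

lemma InClass.exists_pullback {X Y : Type} {C : ComplexityClass} {D : Set (List Y)}
    (h : InClass C D) (T : Transducer X Y) {E : Set (List X)}
    (hE : ∀ w ∈ E, T.output T.start w ∈ D) :
    ∃ M : Machine X, C.AllowsMode M ∧ CorrectFor M E ∧
      C.DecidesOn M {w | T.output T.start w ∉ D} := by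
  obtain ⟨M, hmode, hcorrect, hdecides, htime, hspace⟩ := h
  refine ⟨M.pullback T, fun hC => (hmode hC).pullback T, fun w => ⟨fun hw =>
    absurd hw Machine.not_accepts_pullback, fun hw hwE => ?_⟩, fun w hw => ?_, fun F hF => ?_,
    fun F hF => ?_⟩
  · exact (hcorrect _).2 (Machine.rejects_pullback_iff.1 hw) (hE w hwE)
  · have hrejects : (M.pullback T).Rejects w := Machine.rejects_pullback_iff.2 <|
      (hdecides _ trivial).2.resolve_left fun ha => hw ((hcorrect _).1 ha)
    exact ⟨hrejects.1, .inr hrejects⟩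
  · obtain ⟨f, hf, hbound⟩ := htime F hF
    refine ⟨f, hf, fun w _ => Machine.timeBound_pullback_iff.2 ?_⟩
    simpa only [T.length_output] using hbound (T.output T.start w) trivial
  · obtain ⟨f, hf, hbound⟩ := hspace F hF
    refine ⟨f, hf, fun w _ => Machine.SpaceBound.pullback ?_⟩
    simpa only [T.length_output] using hbound (T.output T.start w) trivial

section WordCount

variable {X : Type}

/-- The number of words of length `n` in a set of words. -/
noncomputable def wordCount (S : Set (List X)) (n : ℕ) : ℕ :=
  {w : List X | w.length = n ∧ w ∈ S}.ncard

lemma finite_setOf_length_eq_and_mem [Finite X] (S : Set (List X)) (n : ℕ) :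
    {w : List X | w.length = n ∧ w ∈ S}.Finite :=
  (List.finite_length_eq X n).subset fun _ h => h.1

lemma wordCount_zero (S : Set (List X)) [Decidable ([] ∈ S)] :
    wordCount S 0 = if [] ∈ S then 1 else 0 := by
  have heq : {w : List X | w.length = 0 ∧ w ∈ S} = {w | w = [] ∧ [] ∈ S} := by
    ext w
    simp +contextual [List.length_eq_zero_iff, and_congr_right_iff]
  rw [wordCount, heq]
  split_ifs with h <;> simp [h]

lemma wordCount_mono [Finite X] {S S' : Set (List X)} (h : S ⊆ S') (n : ℕ) :
    wordCount S n ≤ wordCount S' n :=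
  Set.ncard_le_ncard (fun _ hw => ⟨hw.1, h hw.2⟩) (finite_setOf_length_eq_and_mem S' n)

lemma wordCount_iUnion_le {ι : Type*} [Fintype ι] (S : ι → Set (List X)) (n : ℕ) :
    wordCount (⋃ i, S i) n ≤ ∑ i, wordCount (S i) n := by
  have heq : {w : List X | w.length = n ∧ w ∈ ⋃ i, S i} =
      ⋃ i ∈ Finset.univ, {w : List X | w.length = n ∧ w ∈ S i} := by
    ext w
    simp
  rw [wordCount, heq]
  exact Finset.set_ncard_biUnion_le _ _

lemma ncard_inter_length_le [Finite X] (S : Set (List X)) (n : ℕ) :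
    (S ∩ {w | w.length ≤ n}).ncard = ∑ j ∈ Finset.range (n + 1), wordCount S j := by
  have hfin : (S ∩ {w | w.length ≤ n}).Finite :=
    (List.finite_length_le X n).subset Set.inter_subset_right
  rw [Set.ncard_eq_toFinset_card _ hfin, Finset.card_eq_sum_card_fiberwise
    (f := List.length) (t := Finset.range (n + 1)) fun w hw => by
      simpa [Nat.lt_succ_iff] using (hfin.mem_toFinset.1 hw).2]
  refine Finset.sum_congr rfl fun j hj => ?_
  rw [wordCount, ← Set.ncard_coe_finset]
  congr 1
  ext w
  have hj' : j ≤ n := Nat.lt_succ_iff.1 (Finset.mem_range.1 hj)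
  simp only [Finset.coe_filter, hfin.mem_toFinset, Set.mem_inter_iff, Set.mem_ofPred_eq]
  exact ⟨fun h => ⟨h.2, h.1.1⟩, fun h => ⟨⟨h.2, h.1 ▸ hj'⟩, h.1⟩⟩

variable [Fintype X]

lemma wordCount_succ (S : Set (List X)) (n : ℕ) :
    wordCount S (n + 1) = ∑ x, wordCount {w | x :: w ∈ S} n := by
  have hfin (x : X) : Finite {w : List X | w.length = n ∧ w ∈ {w | x :: w ∈ S}} :=
    (finite_setOf_length_eq_and_mem _ n).to_subtype
  let e : {w : List X | w.length = n + 1 ∧ w ∈ S} ≃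
      Σ x, {w : List X | w.length = n ∧ w ∈ {w | x :: w ∈ S}} :=
    { toFun := fun w => match w with
        | ⟨x :: w, h⟩ => ⟨x, w, by simpa using h.1, h.2⟩
      invFun := fun z => ⟨z.1 :: z.2.1, by simpa using z.2.2.1, z.2.2.2⟩
      left_inv := by
        rintro ⟨_ | ⟨x, w⟩, h⟩
        · simp at h
        · rfl
      right_inv := fun _ => rfl }
  simp only [wordCount, ← Nat.card_coe_set_eq, Nat.card_congr e, Nat.card_sigma]

lemma wordCount_univ (n : ℕ) : wordCount (Set.univ : Set (List X)) n = Fintype.card X ^ n := by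
  classical
  induction n with
  | zero => simp [wordCount_zero]
  | succ n ih =>
    simp [wordCount_succ, Set.mem_univ, Set.ofPred_true, ih, pow_succ']

lemma one_sub_density [Nonempty X] (S : Set (List X)) (n : ℕ) :
    1 - density S n = (∑ j ∈ Finset.range (n + 1), (wordCount Sᶜ j : ℝ)) /
      ∑ j ∈ Finset.range (n + 1), (Fintype.card X : ℝ) ^ j := by
  have hfin := List.finite_length_le X n
  have hadd := Set.ncard_sdiff_add_ncard_of_subset
    (Set.inter_subset_right : S ∩ {w : List X | w.length ≤ n} ⊆ _) hfin
  rw [Set.sdiff_inter_self_eq_sdiff, Set.sdiff_eq, Set.inter_comm _ Sᶜ] at hadd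
  have htotal : (({w | w.length ≤ n} : Set (List X)).ncard : ℝ) =
      ∑ j ∈ Finset.range (n + 1), (Fintype.card X : ℝ) ^ j := by
    rw [← Set.univ_inter {w : List X | w.length ≤ n}, ncard_inter_length_le]
    push_cast [wordCount_univ]
    rfl
  have hpos : (0 : ℝ) < ∑ j ∈ Finset.range (n + 1), (Fintype.card X : ℝ) ^ j :=
    Finset.sum_pos (fun j _ => by have := Fintype.card_pos (α := X); positivity) (by simp)
  rw [eq_div_iff hpos.ne', density, htotal, one_sub_div hpos.ne', div_mul_cancel₀ _ hpos.ne',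
    ← htotal, ← hadd, ncard_inter_length_le Sᶜ]
  push_cast
  ring

lemma generic_of_tendsto [Nonempty X] {S : Set (List X)}
    (h : Tendsto (fun n => (wordCount Sᶜ n : ℝ) / (Fintype.card X : ℝ) ^ n) atTop (𝓝 0)) :
    Generic S := by
  have hcard : (1 : ℝ) ≤ Fintype.card X := mod_cast Fintype.card_pos (α := X)
  have hlittle : (fun n => (wordCount Sᶜ n : ℝ)) =o[atTop] fun n => (Fintype.card X : ℝ) ^ n :=
    (Asymptotics.isLittleO_iff_tendsto fun n hn => absurd hn (by positivity)).2 h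
  have hdiverges : Tendsto (fun n => ∑ j ∈ Finset.range n, (Fintype.card X : ℝ) ^ j)
      atTop atTop := by
    refine tendsto_atTop_mono (fun n => ?_) tendsto_natCast_atTop_atTop
    simpa using Finset.sum_le_sum fun j (_ : j ∈ Finset.range n) => one_le_pow₀ hcard (n := j)
  have hsum := ((hlittle.sum_range (fun n => by positivity)
    hdiverges).tendsto_div_nhds_zero).comp (tendsto_add_atTop_nat 1)
  have hdensity : Tendsto (fun n => 1 - density S n) atTop (𝓝 0) := by
    simpa only [one_sub_density, Function.comp_def] using hsum
  simpa [Generic] using hdensity.const_sub 1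

lemma one_sub_density_le [Nonempty X] {S : Set (List X)} {r C : ℝ} (hr : 1 < r)
    (h : ∀ n, (wordCount Sᶜ n : ℝ) ≤ C * r ^ n) (n : ℕ) :
    1 - density S n ≤ C * r / (r - 1) * (r / Fintype.card X) ^ n := by
  have hC : 0 ≤ C := by simpa using (Nat.cast_nonneg _).trans (h 0)
  have : (0 : ℝ) < Fintype.card X := mod_cast Fintype.card_pos (α := X)
  have hnum : ∑ j ∈ Finset.range (n + 1), (wordCount Sᶜ j : ℝ) ≤ C * r / (r - 1) * r ^ n :=
    calc ∑ j ∈ Finset.range (n + 1), (wordCount Sᶜ j : ℝ)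
        ≤ C * ∑ j ∈ Finset.range (n + 1), r ^ j := by
          rw [Finset.mul_sum]
          exact Finset.sum_le_sum fun j _ => h j
      _ ≤ C * (r ^ (n + 1) / (r - 1)) := by
          rw [geom_sum_eq hr.ne']
          gcongr
          linarith
      _ = C * r / (r - 1) * r ^ n := by ring
  have hden : (Fintype.card X : ℝ) ^ n ≤ ∑ j ∈ Finset.range (n + 1), (Fintype.card X : ℝ) ^ j :=
    Finset.single_le_sum (f := fun j => (Fintype.card X : ℝ) ^ j) (fun j _ => by positivity)
      (Finset.self_mem_range_succ n)
  rw [one_sub_density, div_pow, ← mul_div_assoc]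
  exact div_le_div₀ ((Finset.sum_nonneg fun j _ => by positivity).trans hnum) hnum
    (by positivity) hden

lemma stronglyGeneric_of_le (hX : 2 ≤ Fintype.card X) {S : Set (List X)} {σ C : ℝ} (hσ₀ : 0 ≤ σ)
    (hσ₁ : σ < 1) (h : ∀ n, (wordCount Sᶜ n : ℝ) ≤ C * (σ * Fintype.card X) ^ n) :
    StronglyGeneric S := by
  have : Nonempty X := Fintype.card_pos_iff.1 (by lia)
  have : (2 : ℝ) ≤ Fintype.card X := mod_cast hX
  have hC : 0 ≤ C := by simpa using (Nat.cast_nonneg _).trans (h 0)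
  have hgeneric : Generic S := by
    have hlimit : Tendsto (fun n => C * σ ^ n) atTop (𝓝 0) := by
      simpa using (tendsto_pow_atTop_nhds_zero_of_lt_one hσ₀ hσ₁).const_mul C
    refine generic_of_tendsto (squeeze_zero (fun n => by positivity) (fun n => ?_) hlimit)
    rw [div_le_iff₀ (by positivity), mul_assoc, ← mul_pow]
    exact h n
  -- The geometric sum in the numerator of the density is dominated by its last term only if its
  -- ratio exceeds 1, so `σ` has to be increased when it is small.
  obtain ⟨τ, hστ, hτ, hτ₁⟩ : ∃ τ, σ ≤ τ ∧ 3 / 4 ≤ τ ∧ τ < 1 :=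
    ⟨max σ (3 / 4), le_max_left _ _, le_max_right _ _, max_lt hσ₁ (by norm_num)⟩
  have hr : 1 < τ * Fintype.card X := by nlinarith
  set C' := C * (τ * Fintype.card X) / (τ * Fintype.card X - 1)
  have : 0 ≤ C' := div_nonneg (by positivity) (by linarith)
  refine ⟨hgeneric, τ, C' + 1, by positivity, hτ₁, by positivity, fun n _ => ?_⟩
  have hbound := one_sub_density_le hr (fun n => (h n).trans (by gcongr)) n
  rw [mul_div_cancel_right₀ _ (by positivity)] at hbound
  exact hbound.trans (by gcongr; linarith)

end WordCount

open scoped lp RealInnerProductSpace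

section SquareSummable

variable {X Y : Type*}

lemma hasSum_mul_l2 (f g : ℓ²(X, ℝ)) : HasSum (fun x => f x * g x) ⟪f, g⟫ := by
  simpa [mul_comm] using lp.hasSum_inner (𝕜 := ℝ) f g

lemma hasSum_sq_l2 (f : ℓ²(X, ℝ)) : HasSum (fun x => f x ^ 2) (‖f‖ ^ 2) := by
  simpa only [real_inner_self_eq_norm_sq, ← sq] using hasSum_mul_l2 f f

lemma memℓp_two_of_summable_sq {f : X → ℝ} (hf : Summable fun x => f x ^ 2) : Memℓp f 2 :=
  memℓp_gen (by simpa using hf)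

/-- The restriction of square summable functions along an embedding. -/
noncomputable def l2Restrict (ι : Y ↪ X) : ℓ²(X, ℝ) →L[ℝ] ℓ²(Y, ℝ) :=
  LinearMap.mkContinuous
    { toFun := fun f => ⟨fun y => f (ι y), memℓp_two_of_summable_sq
        ((hasSum_sq_l2 f).summable.comp_injective ι.injective)⟩
      map_add' := fun _ _ => rfl
      map_smul' := fun _ _ => rfl } 1 fun f => by
    rw [one_mul, ← sq_le_sq₀ (norm_nonneg _) (norm_nonneg _), ← (hasSum_sq_l2 _).tsum_eq,
      ← (hasSum_sq_l2 f).tsum_eq]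
    exact tsum_comp_le_tsum_of_inj (hasSum_sq_l2 f).summable (fun _ => sq_nonneg _) ι.injective

@[simp] lemma l2Restrict_apply (ι : Y ↪ X) (f : ℓ²(X, ℝ)) (y : Y) :
    l2Restrict ι f y = f (ι y) := rfl

lemma norm_l2Restrict_apply_le (ι : Y ↪ X) (f : ℓ²(X, ℝ)) : ‖l2Restrict ι f‖ ≤ ‖f‖ :=
  ((l2Restrict ι).le_of_opNorm_le (LinearMap.mkContinuous_norm_le _ zero_le_one _) f).trans_eq
    (one_mul _)

lemma norm_sq_le_sum_norm_sq_l2Restrict {I : Type*} [Fintype I] (ι : I → Y ↪ X)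
    (hι : ∀ x, ∃ i y, ι i y = x) (f : ℓ²(X, ℝ)) :
    ‖f‖ ^ 2 ≤ ∑ i, ‖l2Restrict (ι i) f‖ ^ 2 := by
  choose i y hiy using hι
  have hinj : Function.Injective fun x => (i x, y x) := fun x x' h => by
    obtain ⟨hi, hy⟩ := Prod.ext_iff.1 h
    rw [← hiy x, ← hiy x', show i x = i x' from hi, show y x = y x' from hy]
  have hsum : Summable fun p : I × Y => f (ι p.1 p.2) ^ 2 := by
    refine (summable_prod_of_nonneg fun _ => sq_nonneg _).2 ⟨fun j => ?_, .of_finite⟩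
    exact (hasSum_sq_l2 (l2Restrict (ι j) f)).summable
  calc ‖f‖ ^ 2 = ∑' x, f (ι (i x) (y x)) ^ 2 := by
        simp only [hiy, (hasSum_sq_l2 f).tsum_eq]
    _ ≤ ∑' p : I × Y, f (ι p.1 p.2) ^ 2 :=
        tsum_comp_le_tsum_of_inj hsum (fun _ => sq_nonneg _) hinj
    _ = ∑ j, ‖l2Restrict (ι j) f‖ ^ 2 := by
        rw [hsum.tsum_prod, tsum_fintype]
        exact Finset.sum_congr rfl fun j _ => (hasSum_sq_l2 (l2Restrict (ι j) f)).tsum_eq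

/-- The absolute value of a square summable function. -/
noncomputable def l2Abs (f : ℓ²(X, ℝ)) : ℓ²(X, ℝ) :=
  ⟨fun x => |f x|, memℓp_two_of_summable_sq (by simpa using (hasSum_sq_l2 f).summable)⟩

@[simp] lemma l2Abs_apply (f : ℓ²(X, ℝ)) (x : X) : l2Abs f x = |f x| := rfl

lemma norm_l2Abs (f : ℓ²(X, ℝ)) : ‖l2Abs f‖ = ‖f‖ := by
  rw [← sq_eq_sq₀ (norm_nonneg _) (norm_nonneg _), ← (hasSum_sq_l2 _).tsum_eq,
    ← (hasSum_sq_l2 f).tsum_eq]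
  simp

lemma abs_inner_le_inner_l2Abs {f g h : ℓ²(X, ℝ)} (hg : ∀ x, |g x| ≤ h x) :
    |⟪g, f⟫| ≤ ⟪h, l2Abs f⟫ := by
  have hle (x : X) : |g x * f x| ≤ h x * l2Abs f x := by
    rw [abs_mul]
    exact mul_le_mul_of_nonneg_right (hg x) (abs_nonneg (f x))
  have hsum := hasSum_mul_l2 h (l2Abs f)
  have habs : Summable fun x => |g x * f x| :=
    .of_nonneg_of_le (fun _ => abs_nonneg _) hle hsum.summable
  calc |⟪g, f⟫| = ‖∑' x, g x * f x‖ := by rw [(hasSum_mul_l2 g f).tsum_eq, Real.norm_eq_abs]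
    _ ≤ ∑' x, |g x * f x| := norm_tsum_le_tsum_norm habs
    _ ≤ ∑' x, h x * l2Abs f x := habs.tsum_le_tsum hle hsum.summable
    _ = ⟪h, l2Abs f⟫ := hsum.tsum_eq

open Classical in
/-- The indicator function of a point. -/
noncomputable def pointMass (x : X) : ℓ²(X, ℝ) := lp.single 2 x 1

lemma pointMass_apply [DecidableEq X] (x y : X) : pointMass x y = if y = x then 1 else 0 := by
  classical
  simp [pointMass, lp.single_apply, Pi.single_apply]

lemma norm_pointMass (x : X) : ‖pointMass x‖ = 1 := by
  classical
  simp [pointMass, lp.norm_single]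

lemma inner_pointMass_right (f : ℓ²(X, ℝ)) (x : X) : ⟪f, pointMass x⟫ = f x := by
  classical
  simp [pointMass, lp.inner_single_right]

lemma span_range_pointMass_dense :
    Dense (Submodule.span ℝ (Set.range (pointMass (X := X))) : Set ℓ²(X, ℝ)) := by
  classical
  intro f
  refine mem_closure_of_tendsto (lp.hasSum_single (by norm_num) f) (.of_forall fun s => ?_)
  refine Submodule.sum_mem _ fun x _ => ?_
  have hsingle : lp.single 2 x (f x) = f x • pointMass x := by
    simp [pointMass, ← lp.single_smul]
  rw [hsingle]
  exact Submodule.smul_mem _ _ (Submodule.subset_span ⟨x, rfl⟩)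

end SquareSummable

section PermRep

variable {G X : Type*} [Group G] [MulAction G X]

variable (X) in
/-- The permutation representation of `G` on the square summable functions on a `G`-set. -/
noncomputable def permRep : G →* (ℓ²(X, ℝ) →L[ℝ] ℓ²(X, ℝ)) where
  toFun g := l2Restrict (MulAction.toPerm g⁻¹).toEmbedding
  map_one' := by ext f x; simp
  map_mul' g h := by ext f x; simp [mul_smul]

@[simp] lemma permRep_apply (g : G) (f : ℓ²(X, ℝ)) (x : X) : permRep X g f x = f (g⁻¹ • x) := rfl

lemma inner_permRep_left (g : G) (f h : ℓ²(X, ℝ)) :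
    ⟪permRep X g f, h⟫ = ⟪f, permRep X g⁻¹ h⟫ := by
  rw [← (hasSum_mul_l2 _ h).tsum_eq, ← (hasSum_mul_l2 f _).tsum_eq,
    ← (MulAction.toPerm g).tsum_eq]
  simp

@[simp] lemma norm_permRep (g : G) (f : ℓ²(X, ℝ)) : ‖permRep X g f‖ = ‖f‖ := by
  rw [← sq_eq_sq₀ (norm_nonneg _) (norm_nonneg _), ← (hasSum_sq_l2 _).tsum_eq,
    ← (hasSum_sq_l2 f).tsum_eq, ← (MulAction.toPerm g).tsum_eq]
  simp

lemma norm_permRep_mul_sub_le (g h : G) (f : ℓ²(X, ℝ)) :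
    ‖permRep X (g * h) f - f‖ ≤ ‖permRep X g f - f‖ + ‖permRep X h f - f‖ := by
  have hsplit : permRep X (g * h) f - f =
      permRep X g (permRep X h f - f) + (permRep X g f - f) := by
    rw [map_mul, mul_apply_eq_comp, map_sub]
    abel
  rw [hsplit, add_comm ‖permRep X g f - f‖, ← norm_permRep g (permRep X h f - f)]
  exact norm_add_le _ _

end PermRep

section Words

variable {G : Type*} [Group G] {k : ℕ} (a : Fin k → G)

lemma letterVal_not (x : Fin k × Bool) : letterVal a (x.1, !x.2) = (letterVal a x)⁻¹ := by
  rcases x with ⟨i, _ | _⟩ <;> simp [letterVal]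

lemma sum_letterVal_inv {M : Type*} [AddCommMonoid M] (F : G → M) :
    ∑ x, F (letterVal a x)⁻¹ = ∑ x, F (letterVal a x) := by
  simp only [← letterVal_not]
  exact Fintype.sum_equiv ((Equiv.refl (Fin k)).prodCongr Equiv.boolNot) _ _ fun _ => rfl

lemma wordVal_nil : wordVal a [] = 1 := rfl

lemma wordVal_cons (x : Fin k × Bool) (w : List (Fin k × Bool)) :
    wordVal a (x :: w) = letterVal a x * wordVal a w := by
  simp [wordVal]

lemma card_letters : (Fintype.card (Fin k × Bool) : ℝ) = 2 * k := by
  simp [mul_comm]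

variable {a}

lemma Generates.induction (ha : Generates a) {p : G → Prop} (one : p 1)
    (mul : ∀ x g, p g → p (letterVal a x * g)) (g : G) : p g := by
  have hg : g ∈ Subgroup.closure (Set.range a) := by rw [ha]; trivial
  induction hg using Subgroup.closure_induction_left with
  | one => exact one
  | mul_left x hx y _ ih =>
    obtain ⟨i, rfl⟩ := hx
    simpa [letterVal] using mul (i, true) y ih
  | inv_mul_cancel x hx y _ ih =>
    obtain ⟨i, rfl⟩ := hx
    simpa [letterVal] using mul (i, false) y ih

lemma wordVal_mem_closure (w : List (Fin k × Bool)) :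
    wordVal a w ∈ Subgroup.closure (Set.range a) := by
  induction w with
  | nil => exact one_mem _
  | cons x w ih =>
    rw [wordVal_cons, letterVal]
    have hx := Subgroup.subset_closure (Set.mem_range_self (f := a) x.1)
    split_ifs
    exacts [mul_mem hx ih, mul_mem (inv_mem hx) ih]

lemma Generates.exists_wordVal_eq (ha : Generates a) (g : G) : ∃ w, wordVal a w = g := by
  induction g using ha.induction with
  | one => exact ⟨[], rfl⟩
  | mul x g ih =>
    obtain ⟨w, rfl⟩ := ih
    exact ⟨x :: w, wordVal_cons a x w⟩

lemma Generates.pos_of_nontrivial [Nontrivial G] (ha : Generates a) : 0 < k := by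
  obtain ⟨g, hg⟩ := exists_ne (1 : G)
  by_contra! hk
  obtain rfl := Nat.le_zero.1 hk
  exact hg (ha.induction (p := fun g => g = 1) rfl (fun x => x.1.elim0) g)

end Words

section Walk

variable {G X : Type*} [Group G] [MulAction G X] {k : ℕ} (a : Fin k → G)

variable (X) in
/-- The transition operator of the random walk on a `G`-set that moves along a uniformly chosen
letter. -/
noncomputable def walkOp : ℓ²(X, ℝ) →L[ℝ] ℓ²(X, ℝ) :=
  (2 * (k : ℝ))⁻¹ • ∑ x, permRep X (letterVal a x)

lemma walkOp_eq (f : ℓ²(X, ℝ)) :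
    walkOp X a f = (2 * (k : ℝ))⁻¹ • ∑ x, permRep X (letterVal a x) f := by
  simp [walkOp]

lemma walkOp_apply (f : ℓ²(X, ℝ)) (v : X) :
    walkOp X a f v = (∑ x, f ((letterVal a x)⁻¹ • v)) / (2 * (k : ℝ)) := by
  rw [walkOp_eq, lp.coeFn_smul, lp.coeFn_sum, Pi.smul_apply, Finset.sum_apply, smul_eq_mul,
    inv_mul_eq_div]
  simp only [permRep_apply]

lemma two_mul_smul_walkOp (f : ℓ²(X, ℝ)) :
    (2 * (k : ℝ)) • walkOp X a f = ∑ x, permRep X (letterVal a x) f := by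
  rcases eq_or_ne k 0 with rfl | hk
  · simp
  · rw [walkOp_eq, smul_inv_smul₀ (by positivity)]

lemma isSymmetric_walkOp : (walkOp X a : ℓ²(X, ℝ) →ₗ[ℝ] ℓ²(X, ℝ)).IsSymmetric := fun f h => by
  simp only [ContinuousLinearMap.coe_coe, walkOp_eq, real_inner_smul_left, real_inner_smul_right,
    sum_inner, inner_sum, inner_permRep_left]
  rw [sum_letterVal_inv a fun g => ⟪f, permRep X g h⟫]

lemma norm_walkOp_le_one : ‖walkOp X a‖ ≤ 1 := by
  refine ContinuousLinearMap.opNorm_le_bound _ zero_le_one fun f => ?_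
  have hsum : ‖∑ x, permRep X (letterVal a x) f‖ ≤ 2 * k * ‖f‖ :=
    (norm_sum_le _ _).trans_eq (by simp [mul_comm])
  rw [walkOp_eq, norm_smul, norm_inv, Real.norm_of_nonneg (by positivity), one_mul]
  exact inv_mul_le_of_le_mul₀ (by positivity) (norm_nonneg f) hsum

lemma walkOp_pow_pointMass (n : ℕ) (u v : X) :
    (walkOp X a ^ n) (pointMass u) v =
      (wordCount {w | wordVal a w • u = v} n : ℝ) / (2 * (k : ℝ)) ^ n := by
  classical
  induction n generalizing v with
  | zero =>
    rw [wordCount_zero]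
    simp [wordVal_nil, pointMass_apply, eq_comm]
  | succ n ih =>
    have hcons (x : Fin k × Bool) : {w | wordVal a (x :: w) • u = v} =
        {w | wordVal a w • u = (letterVal a x)⁻¹ • v} := by
      simp only [wordVal_cons, mul_smul, eq_inv_smul_iff]
    rw [pow_succ', mul_apply_eq_comp, walkOp_apply, wordCount_succ]
    simp only [ih, Set.mem_ofPred_eq, hcons]
    rw [← Finset.sum_div, div_div, ← pow_succ, Nat.cast_sum]

lemma sum_norm_permRep_letterVal_sub_sq (f h : ℓ²(X, ℝ)) :
    ∑ x, ‖permRep X (letterVal a x) f - h‖ ^ 2 =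
      2 * k * (‖f‖ ^ 2 - 2 * ⟪walkOp X a f, h⟫ + ‖h‖ ^ 2) := by
  have hinner : ∑ x, ⟪permRep X (letterVal a x) f, h⟫ = 2 * k * ⟪walkOp X a f, h⟫ := by
    rw [← sum_inner, ← two_mul_smul_walkOp, real_inner_smul_left]
  simp only [norm_sub_sq_real, norm_permRep, Finset.sum_add_distrib, Finset.sum_sub_distrib,
    ← Finset.mul_sum, hinner, Finset.sum_const, Finset.card_univ, nsmul_eq_mul, card_letters]
  ring

end Walk

section SymmetricOperator

variable {E : Type*} [NormedAddCommGroup E] [InnerProductSpace ℝ E] {T : E →L[ℝ] E}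

lemma inner_pow_apply_pow_apply (hT : (T : E →ₗ[ℝ] E).IsSymmetric) (m n : ℕ) (f h : E) :
    ⟪(T ^ m) f, (T ^ n) h⟫ = ⟪(T ^ (m + n)) f, h⟫ := by
  have hsymm : ((T ^ n : E →L[ℝ] E) : E →ₗ[ℝ] E).IsSymmetric := by
    rw [ContinuousLinearMap.toLinearMap_pow]
    exact hT.pow n
  rw [add_comm, pow_add, mul_apply_eq_comp]
  exact (hsymm _ _).symm

lemma tendsto_norm_pow_apply_of_isSymmetric [CompleteSpace E]
    (hT : (T : E →ₗ[ℝ] E).IsSymmetric) (hnorm : ‖T‖ ≤ 1) (hfix : ∀ f, T (T f) = f → f = 0)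
    (f : E) : Tendsto (fun n => ‖(T ^ n) f‖) atTop (𝓝 0) := by
  have hsq (n : ℕ) : ‖(T ^ n) f‖ ^ 2 = ⟪((T ^ 2) ^ n) f, f⟫ := by
    rw [← real_inner_self_eq_norm_sq, inner_pow_apply_pow_apply hT, ← pow_mul, two_mul]
  have hanti : Antitone fun n => ‖(T ^ n) f‖ ^ 2 := antitone_nat_of_succ_le fun n => by
    rw [pow_succ' T, mul_apply_eq_comp]
    gcongr
    exact (T.le_of_opNorm_le hnorm _).trans_eq (one_mul _)
  obtain ⟨L, hL⟩ : ∃ L, Tendsto (fun n => ‖(T ^ n) f‖ ^ 2) atTop (𝓝 L) :=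
    ⟨_, tendsto_atTop_ciInf hanti ⟨0, by rintro _ ⟨n, rfl⟩; positivity⟩⟩
  -- By the mean ergodic theorem, the averages of `(T ^ 2) ^ n f` tend to a fixed vector of `T ^ 2`.
  have hmean : Tendsto (birkhoffAverage ℝ ⇑(T ^ 2) _root_.id · f) atTop (𝓝 0) := by
    convert (T ^ 2).tendsto_birkhoffAverage_orthogonalProjection
      ((norm_pow_le' T two_pos).trans (pow_le_one₀ (norm_nonneg T) hnorm)) f
    refine (hfix _ ?_).symm
    rw [← mul_apply_eq_comp, ← sq]
    exact (((T ^ 2).eqLocus (1 : E →L[ℝ] E)).orthogonalProjectionOnto f).2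
  have hinner (n : ℕ) : ⟪birkhoffAverage ℝ ⇑(T ^ 2) _root_.id n f, f⟫ =
      (n⁻¹ : ℝ) * ∑ i ∈ Finset.range n, ‖(T ^ i) f‖ ^ 2 := by
    simp only [birkhoffAverage, birkhoffSum, real_inner_smul_left, sum_inner, hsq, _root_.id,
      ← FunLike.coe_pow_eq_iterate]
  have hL0 : L = 0 := tendsto_nhds_unique hL.cesaro (by
    simpa only [hinner, inner_zero_left] using hmean.inner (𝕜 := ℝ) (tendsto_const_nhds (x := f)))
  simpa only [hL0, Real.sqrt_zero, Real.sqrt_sq (norm_nonneg _)] using hL.sqrt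

lemma norm_apply_mul_norm_pow_apply_le (hT : (T : E →ₗ[ℝ] E).IsSymmetric) (f : E) (n : ℕ) :
    ‖T f‖ * ‖(T ^ n) f‖ ≤ ‖f‖ * ‖(T ^ (n + 1)) f‖ := by
  induction n with
  | zero => simp [mul_comm]
  | succ n ih =>
    rcases (norm_nonneg ((T ^ (n + 1)) f)).eq_or_lt with h0 | hpos
    · rw [← h0, mul_zero]
      positivity
    have hlogconvex : ‖(T ^ (n + 1)) f‖ ^ 2 ≤ ‖(T ^ n) f‖ * ‖(T ^ (n + 2)) f‖ := by
      rw [← real_inner_self_eq_norm_sq, inner_pow_apply_pow_apply hT,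
        show n + 1 + (n + 1) = n + (n + 2) by ring, ← inner_pow_apply_pow_apply hT]
      exact real_inner_le_norm _ _
    refine le_of_mul_le_mul_right ?_ hpos
    calc ‖T f‖ * ‖(T ^ (n + 1)) f‖ * ‖(T ^ (n + 1)) f‖
        ≤ ‖T f‖ * (‖(T ^ n) f‖ * ‖(T ^ (n + 2)) f‖) := by
          rw [mul_assoc, ← sq]
          gcongr
      _ ≤ ‖f‖ * ‖(T ^ (n + 1)) f‖ * ‖(T ^ (n + 2)) f‖ := by
          rw [← mul_assoc]
          gcongr
      _ = ‖f‖ * ‖(T ^ (n + 2)) f‖ * ‖(T ^ (n + 1)) f‖ := by ring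

lemma norm_apply_le_of_norm_pow_apply_le (hT : (T : E →ₗ[ℝ] E).IsSymmetric) {f : E} {C σ : ℝ}
    (hσ : 0 ≤ σ) (hf : ∀ n, ‖(T ^ n) f‖ ≤ C * σ ^ n) : ‖T f‖ ≤ σ * ‖f‖ := by
  have hpow (n : ℕ) : ‖T f‖ ^ n * ‖f‖ ≤ C * (σ * ‖f‖) ^ n := by
    have hgrowth : ‖T f‖ ^ n * ‖f‖ ≤ ‖f‖ ^ n * ‖(T ^ n) f‖ := by
      induction n with
      | zero => simp
      | succ n ih =>
        calc ‖T f‖ ^ (n + 1) * ‖f‖ = ‖T f‖ * (‖T f‖ ^ n * ‖f‖) := by ring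
          _ ≤ ‖f‖ ^ n * (‖T f‖ * ‖(T ^ n) f‖) := by nlinarith [norm_nonneg (T f)]
          _ ≤ ‖f‖ ^ n * (‖f‖ * ‖(T ^ (n + 1)) f‖) :=
            mul_le_mul_of_nonneg_left (norm_apply_mul_norm_pow_apply_le hT f n) (by positivity)
          _ = ‖f‖ ^ (n + 1) * ‖(T ^ (n + 1)) f‖ := by ring
    calc ‖T f‖ ^ n * ‖f‖ ≤ ‖f‖ ^ n * (C * σ ^ n) := hgrowth.trans (by gcongr; exact hf n)
      _ = C * (σ * ‖f‖) ^ n := by ring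
  by_contra! hlt
  have hTf : 0 < ‖T f‖ := hlt.trans_le' (by positivity)
  have hlim : Tendsto (fun n : ℕ => C * (σ * ‖f‖ / ‖T f‖) ^ n) atTop (𝓝 0) := by
    simpa using (tendsto_pow_atTop_nhds_zero_of_lt_one (by positivity)
      ((div_lt_one hTf).2 hlt)).const_mul C
  have hf0 : ‖f‖ ≤ 0 := ge_of_tendsto' hlim fun n => by
    rw [div_pow, ← mul_div_assoc, le_div_iff₀ (by positivity), mul_comm]
    exact hpow n
  rw [norm_le_zero_iff.1 hf0, map_zero, norm_zero] at hTf
  exact hTf.false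

lemma opNorm_le_of_norm_pow_apply_le (hT : (T : E →ₗ[ℝ] E).IsSymmetric) {σ : ℝ} (hσ : 0 ≤ σ)
    {s : Set E} (hs : Dense (Submodule.span ℝ s : Set E))
    (h : ∀ f ∈ s, ∃ C : ℝ, ∀ n, ‖(T ^ n) f‖ ≤ C * σ ^ n) : ‖T‖ ≤ σ := by
  have hspan (f : E) (hf : f ∈ Submodule.span ℝ s) : ∃ C : ℝ, ∀ n, ‖(T ^ n) f‖ ≤ C * σ ^ n := by
    induction hf using Submodule.span_induction with
    | mem f hf => exact h f hf
    | zero => exact ⟨0, fun n => by simp⟩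
    | add f g _ _ hf hg =>
      obtain ⟨C, hC⟩ := hf
      obtain ⟨D, hD⟩ := hg
      refine ⟨C + D, fun n => ?_⟩
      rw [map_add, add_mul]
      exact norm_add_le_of_le (hC n) (hD n)
    | smul c f _ hf =>
      obtain ⟨C, hC⟩ := hf
      refine ⟨|c| * C, fun n => ?_⟩
      rw [map_smul, norm_smul, Real.norm_eq_abs, mul_assoc]
      gcongr
      exact hC n
  refine T.opNorm_le_bound hσ fun f => hs.induction (fun f hf => ?_) ?_ f
  · exact norm_apply_le_of_norm_pow_apply_le hT hσ (hspan f hf).choose_spec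
  · exact isClosed_le (by fun_prop) (by fun_prop)

end SymmetricOperator

section Escape

variable {G X : Type*} [Group G] [MulAction G X] {k : ℕ} {a : Fin k → G}

lemma permRep_letterVal_eq_walkOp {f : ℓ²(X, ℝ)} (hf : ‖walkOp X a f‖ = ‖f‖)
    (x : Fin k × Bool) : permRep X (letterVal a x) f = walkOp X a f := by
  have hsum : ∑ x, ‖permRep X (letterVal a x) f - walkOp X a f‖ ^ 2 = 0 := by
    rw [sum_norm_permRep_letterVal_sub_sq, real_inner_self_eq_norm_sq, hf]
    ring
  have hx := (Finset.sum_eq_zero_iff_of_nonneg fun _ _ => sq_nonneg _).1 hsum x (Finset.mem_univ x)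
  exact sub_eq_zero.1 (norm_eq_zero.1 (sq_eq_zero_iff.1 hx))

lemma eq_zero_of_walkOp_walkOp_eq_self [Infinite X] [MulAction.IsPretransitive G X]
    (ha : Generates a) {f : ℓ²(X, ℝ)} (hf : walkOp X a (walkOp X a f) = f) : f = 0 := by
  have hcontr (h : ℓ²(X, ℝ)) : ‖walkOp X a h‖ ≤ ‖h‖ :=
    ((walkOp X a).le_of_opNorm_le (norm_walkOp_le_one a) h).trans_eq (one_mul _)
  have hnorm : ‖walkOp X a f‖ = ‖f‖ :=
    (hcontr f).antisymm (by simpa only [hf] using hcontr (walkOp X a f))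
  have horbit (g : G) : permRep X g f = f ∨ permRep X g f = walkOp X a f := by
    induction g using ha.induction with
    | one => simp
    | mul x g ih =>
      rw [map_mul, mul_apply_eq_comp]
      rcases ih with ih | ih <;> rw [ih]
      · exact .inr (permRep_letterVal_eq_walkOp hnorm x)
      · exact .inl ((permRep_letterVal_eq_walkOp (by rw [hf, hnorm]) x).trans hf)
  ext u
  have hle (v : X) : f u ^ 2 ≤ f v ^ 2 + walkOp X a f v ^ 2 := by
    obtain ⟨g, rfl⟩ := MulAction.exists_smul_eq G u v
    have hu : f u = permRep X g f (g • u) := by simp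
    rcases horbit g with h | h <;> rw [hu, h] <;> simp [sq_nonneg]
  have hconst : Summable fun _ : X => f u ^ 2 :=
    .of_nonneg_of_le (fun _ => sq_nonneg _) hle
      ((hasSum_sq_l2 f).summable.add (hasSum_sq_l2 (walkOp X a f)).summable)
  exact sq_eq_zero_iff.1 ((summable_const_iff _).1 hconst)

lemma tendsto_wordCount_div_pow [Infinite X] [MulAction.IsPretransitive G X] (ha : Generates a)
    (u v : X) : Tendsto (fun n => (wordCount {w | wordVal a w • u = v} n : ℝ) /
      (2 * (k : ℝ)) ^ n) atTop (𝓝 0) := by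
  simp only [← walkOp_pow_pointMass]
  exact squeeze_zero_norm (fun n => lp.norm_apply_le_norm two_ne_zero _ v)
    (tendsto_norm_pow_apply_of_isSymmetric (isSymmetric_walkOp a) (norm_walkOp_le_one a)
      (fun _ => eq_zero_of_walkOp_walkOp_eq_self ha) (pointMass u))

lemma wordCount_le_norm_walkOp_pow (hk : 0 < k) (u v : X) (n : ℕ) :
    (wordCount {w | wordVal a w • u = v} n : ℝ) ≤ (‖walkOp X a‖ * (2 * k)) ^ n := by
  rw [mul_pow, ← div_le_iff₀ (by positivity), ← walkOp_pow_pointMass]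
  have hpow : ‖(walkOp X a ^ n) (pointMass u)‖ ≤ ‖walkOp X a‖ ^ n := by
    induction n with
    | zero => simp [norm_pointMass]
    | succ n ih =>
      rw [pow_succ', pow_succ', mul_apply_eq_comp]
      exact (walkOp X a).le_opNorm_of_le ih
  exact (le_abs_self _).trans ((lp.norm_apply_le_norm two_ne_zero
    ((walkOp X a ^ n) (pointMass u)) v).trans hpow)

end Escape

section SpectralRadius

variable {G X : Type*} [Group G] [MulAction G X] {k : ℕ} {a : Fin k → G}

lemma walkOp_pow_mono {f h : ℓ²(X, ℝ)} (hfh : ∀ v, f v ≤ h v) (n : ℕ) (v : X) :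
    (walkOp X a ^ n) f v ≤ (walkOp X a ^ n) h v := by
  induction n generalizing v with
  | zero => exact hfh v
  | succ n ih =>
    simp only [pow_succ' (walkOp X a), mul_apply_eq_comp, walkOp_apply]
    gcongr with x
    exact ih _

lemma pointMass_smul_le_walkOp_pointMass (x : Fin k × Bool) (u v : X) :
    pointMass (letterVal a x • u) v ≤ ((2 * (k : ℝ)) • walkOp X a (pointMass u)) v := by
  classical
  have hterm : pointMass (letterVal a x • u) v = permRep X (letterVal a x) (pointMass u) v := by
    simp only [permRep_apply, pointMass_apply, inv_smul_eq_iff]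
  rw [two_mul_smul_walkOp, lp.coeFn_sum, Finset.sum_apply, hterm]
  refine Finset.single_le_sum (f := fun y => permRep X (letterVal a y) (pointMass u) v)
    (fun y _ => ?_) (Finset.mem_univ x)
  rw [permRep_apply, pointMass_apply]
  split_ifs <;> norm_num

lemma norm_walkOp_pow_pointMass_smul_le (x : Fin k × Bool) (u : X) (n : ℕ) :
    ‖(walkOp X a ^ n) (pointMass (letterVal a x • u))‖ ≤
      2 * k * ‖(walkOp X a ^ (n + 1)) (pointMass u)‖ := by
  have hsmul : (walkOp X a ^ n) ((2 * (k : ℝ)) • walkOp X a (pointMass u)) =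
      (2 * (k : ℝ)) • (walkOp X a ^ (n + 1)) (pointMass u) := by
    rw [map_smul, pow_succ, mul_apply_eq_comp]
  have hle (v : X) : ‖(walkOp X a ^ n) (pointMass (letterVal a x • u)) v‖ ≤
      ‖(walkOp X a ^ n) ((2 * (k : ℝ)) • walkOp X a (pointMass u)) v‖ := by
    rw [Real.norm_of_nonneg (by rw [walkOp_pow_pointMass]; positivity)]
    exact (walkOp_pow_mono (pointMass_smul_le_walkOp_pointMass x u) n v).trans (le_abs_self _)
  refine (lp.norm_mono two_ne_zero hle).trans_eq ?_
  rw [hsmul, norm_smul, Real.norm_of_nonneg (by positivity)]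

lemma norm_walkOp_le_of_return_le [MulAction.IsPretransitive G X] (ha : Generates a) {u : X}
    {C σ : ℝ} (hσ : 0 ≤ σ) (h : ∀ n, (walkOp X a ^ n) (pointMass u) u ≤ C * σ ^ n) :
    ‖walkOp X a‖ ≤ σ := by
  refine opNorm_le_of_norm_pow_apply_le (isSymmetric_walkOp a) hσ span_range_pointMass_dense ?_
  rintro _ ⟨v, rfl⟩
  obtain ⟨g, rfl⟩ := MulAction.exists_smul_eq G u v
  induction g using ha.induction with
  | one =>
    refine ⟨√C, fun n => ?_⟩
    rw [one_smul, ← abs_of_nonneg (norm_nonneg _), ← abs_of_nonneg (pow_nonneg hσ n),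
      ← Real.sqrt_sq_eq_abs, ← Real.sqrt_sq_eq_abs, ← Real.sqrt_mul' C (sq_nonneg _)]
    refine Real.sqrt_le_sqrt ?_
    rw [← real_inner_self_eq_norm_sq, inner_pow_apply_pow_apply (isSymmetric_walkOp a),
      inner_pointMass_right, ← pow_mul, mul_two]
    exact h (n + n)
  | mul x g ih =>
    obtain ⟨C, hC⟩ := ih
    refine ⟨2 * k * (C * σ), fun n => ?_⟩
    calc ‖(walkOp X a ^ n) (pointMass ((letterVal a x * g) • u))‖
        ≤ 2 * k * ‖(walkOp X a ^ (n + 1)) (pointMass (g • u))‖ := by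
          rw [mul_smul]
          exact norm_walkOp_pow_pointMass_smul_le x (g • u) n
      _ ≤ 2 * k * (C * σ ^ (n + 1)) := by
          gcongr
          exact hC (n + 1)
      _ = 2 * k * (C * σ) * σ ^ n := by ring

variable {H : Subgroup G}

lemma smul_mk_one_eq_iff {g : G} :
    g • ((1 : G) : G ⧸ H) = ((1 : G) : G ⧸ H) ↔ g ∈ H := by
  rw [← MulAction.mem_stabilizer_iff, MulAction.stabilizer_quotient]

lemma pathEnd_mk (g : G) (p : List (Fin k × Bool)) :
    pathEnd H a (Quotient.mk'' g) p = Quotient.mk'' (g * wordVal a p) := by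
  induction p generalizing g with
  | nil => simp [pathEnd, wordVal_nil]
  | cons x p ih =>
    rw [wordVal_cons, ← mul_assoc, ← ih]
    rfl

variable (H a) in
lemma closedPaths_eq_wordCount (n : ℕ) :
    closedPaths H a n =
      wordCount {w | wordVal a w • ((1 : G) : G ⧸ H) = ((1 : G) : G ⧸ H)} n := by
  unfold closedPaths wordCount
  congr 1
  ext w
  simp only [Set.mem_ofPred_eq, smul_mk_one_eq_iff, pathEnd_mk, one_mul]
  rw [Quotient.eq'', QuotientGroup.rightRel_apply]
  simp

lemma rpow_closedPaths_le {s : ℝ} (hs : 0 ≤ s) {n : ℕ} (hn : n ≠ 0) :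
    (closedPaths H a n : ℝ) ^ (1 / (n : ℝ)) ≤ s ↔ (closedPaths H a n : ℝ) ≤ s ^ n := by
  rw [one_div, Real.rpow_inv_le_iff_of_pos (by positivity) hs (by positivity), Real.rpow_natCast]

lemma norm_walkOp_le_of_eventually_rpow_closedPaths_lt (hk : 0 < k) (ha : Generates a) {s : ℝ}
    (h : ∀ᶠ n : ℕ in atTop, (closedPaths H a n : ℝ) ^ (1 / (n : ℝ)) < s) :
    ‖walkOp (G ⧸ H) a‖ * (2 * k) ≤ s := by
  have hs : 0 < s := by
    obtain ⟨n, hn⟩ := h.exists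
    exact hn.trans_le' (by positivity)
  have hratio : ∀ᶠ n : ℕ in atTop, (closedPaths H a n : ℝ) / s ^ n ≤ 1 := by
    filter_upwards [h, eventually_ne_atTop 0] with n hn hn0
    exact (div_le_one (by positivity)).2 ((rpow_closedPaths_le hs.le hn0).1 hn.le)
  obtain ⟨C, hC⟩ := (show IsBoundedUnder (· ≤ ·) atTop
    fun n : ℕ => (closedPaths H a n : ℝ) / s ^ n from ⟨1, hratio⟩).bddAbove_range
  rw [← le_div_iff₀ (by positivity)]
  refine norm_walkOp_le_of_return_le ha (u := ((1 : G) : G ⧸ H)) (C := C) (by positivity)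
    fun n => ?_
  rw [walkOp_pow_pointMass, ← closedPaths_eq_wordCount, div_pow, ← mul_div_assoc]
  gcongr
  exact (div_le_iff₀ (by positivity)).1 (hC ⟨n, rfl⟩)

theorem spectralRadius_eq_norm_walkOp (hk : 0 < k) (ha : Generates a) :
    spectralRadius H a = ‖walkOp (G ⧸ H) a‖ := by
  have hle : ∀ᶠ n : ℕ in atTop,
      (closedPaths H a n : ℝ) ^ (1 / (n : ℝ)) ≤ ‖walkOp (G ⧸ H) a‖ * (2 * k) := by
    filter_upwards [eventually_ne_atTop 0] with n hn
    rw [rpow_closedPaths_le (by positivity) hn, closedPaths_eq_wordCount]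
    exact wordCount_le_norm_walkOp_pow hk _ _ n
  rw [spectralRadius, div_eq_iff (by positivity)]
  refine le_antisymm (limsup_le_of_le ?_ hle) (le_of_forall_gt_imp_ge_of_dense fun s hs => ?_)
  · exact IsBoundedUnder.isCoboundedUnder_le ⟨0, by simpa using ⟨0, fun n _ => by positivity⟩⟩
  · exact norm_walkOp_le_of_eventually_rpow_closedPaths_lt hk ha
      (eventually_lt_of_limsup_lt hs ⟨_, hle⟩)

lemma not_schreierAmenable_iff_norm_walkOp_lt_one (hk : 0 < k) (ha : Generates a) :
    ¬ SchreierAmenable H a ↔ ‖walkOp (G ⧸ H) a‖ < 1 := by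
  rw [SchreierAmenable, spectralRadius_eq_norm_walkOp hk ha,
    (norm_walkOp_le_one a).lt_iff_ne]

end SpectralRadius

section SpectralGap

/-- The permutation representation of `G` on the square summable functions on the `G`-set `X` has
no almost invariant vectors. -/
def HasSpectralGap (G X : Type*) [Group G] [MulAction G X] : Prop :=
  ∃ (F : Finset G) (ε : ℝ), 0 < ε ∧ ∀ f : ℓ²(X, ℝ), ∃ g ∈ F, ε * ‖f‖ ≤ ‖permRep X g f - f‖

variable {G X : Type*} [Group G] [MulAction G X] {k : ℕ} {a : Fin k → G}

lemma hasSpectralGap_of_norm_walkOp_lt_one (hk : 0 < k) (h : ‖walkOp X a‖ < 1) :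
    HasSpectralGap G X := by
  classical
  refine ⟨Finset.univ.image (letterVal a), 1 - ‖walkOp X a‖, sub_pos.2 h, fun f => ?_⟩
  have hsum : ∑ _x : Fin k × Bool, (1 - ‖walkOp X a‖) * ‖f‖ ≤
      ∑ x, ‖permRep X (letterVal a x) f - f‖ := by
    calc ∑ _x : Fin k × Bool, (1 - ‖walkOp X a‖) * ‖f‖
        = 2 * k * (‖f‖ - ‖walkOp X a‖ * ‖f‖) := by
          rw [Finset.sum_const, Finset.card_univ, nsmul_eq_mul, card_letters]
          ring
      _ ≤ 2 * k * ‖walkOp X a f - f‖ := by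
          gcongr
          rw [norm_sub_rev]
          exact (sub_le_sub_left ((walkOp X a).le_opNorm f) _).trans (norm_sub_norm_le _ _)
      _ = ‖∑ x, (permRep X (letterVal a x) f - f)‖ := by
          rw [Finset.sum_sub_distrib, ← two_mul_smul_walkOp, Finset.sum_const, Finset.card_univ,
            ← Nat.cast_smul_eq_nsmul ℝ, card_letters, ← smul_sub, norm_smul,
            Real.norm_of_nonneg (by positivity)]
      _ ≤ ∑ x, ‖permRep X (letterVal a x) f - f‖ := norm_sum_le _ _
  obtain ⟨x, -, hx⟩ := Finset.exists_le_of_sum_le ⟨(⟨0, hk⟩, true), Finset.mem_univ _⟩ hsum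
  exact ⟨letterVal a x, Finset.mem_image_of_mem _ (Finset.mem_univ x), hx⟩

lemma exists_norm_permRep_sub_le (ha : Generates a) (X : Type*) [MulAction G X] (F : Finset G) :
    ∃ C : ℝ, 0 < C ∧ ∀ g ∈ F, ∀ f : ℓ²(X, ℝ),
      ‖permRep X g f - f‖ ≤ C * ∑ x, ‖permRep X (letterVal a x) f - f‖ := by
  have hone (g : G) : ∃ C : ℝ, 0 < C ∧ ∀ f : ℓ²(X, ℝ),
      ‖permRep X g f - f‖ ≤ C * ∑ x, ‖permRep X (letterVal a x) f - f‖ := by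
    induction g using ha.induction with
    | one => exact ⟨1, one_pos, fun f => by simpa using Finset.sum_nonneg fun _ _ => norm_nonneg _⟩
    | mul x g ih =>
      obtain ⟨C, hC, h⟩ := ih
      refine ⟨1 + C, by positivity, fun f => (norm_permRep_mul_sub_le _ g f).trans ?_⟩
      rw [one_add_mul]
      exact add_le_add (Finset.single_le_sum (f := fun x => ‖permRep X (letterVal a x) f - f‖)
        (fun _ _ => norm_nonneg _) (Finset.mem_univ x)) (h f)
  choose C hC h using hone
  have hsum : 0 ≤ ∑ g ∈ F, C g := Finset.sum_nonneg fun g _ => (hC g).le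
  refine ⟨1 + ∑ g ∈ F, C g, by positivity,
    fun g hg f => (h g f).trans (mul_le_mul_of_nonneg_right ?_ (by positivity))⟩
  exact (Finset.single_le_sum (fun g _ => (hC g).le) hg).trans (le_add_of_nonneg_left zero_le_one)

lemma abs_inner_walkOp_le (f : ℓ²(X, ℝ)) :
    |⟪walkOp X a f, f⟫| ≤ ⟪walkOp X a (l2Abs f), l2Abs f⟫ := by
  refine abs_inner_le_inner_l2Abs fun v => ?_
  rw [walkOp_apply, walkOp_apply, abs_div, abs_of_nonneg (by positivity : 0 ≤ 2 * (k : ℝ))]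
  gcongr
  exact Finset.abs_sum_le_sum_abs _ _

lemma norm_walkOp_le_of_inner_le {q : ℝ} (hq : 0 ≤ q)
    (h : ∀ f : ℓ²(X, ℝ), ⟪walkOp X a f, f⟫ ≤ q * ‖f‖ ^ 2) : ‖walkOp X a‖ ≤ q := by
  rw [ContinuousLinearMap.norm_eq_iSup_rayleighQuotient _ (isSymmetric_walkOp a)]
  refine Real.iSup_le (fun f => ?_) hq
  rw [ContinuousLinearMap.rayleighQuotient, ContinuousLinearMap.reApplyInnerSelf_apply, abs_div,
    abs_of_nonneg (sq_nonneg ‖f‖)]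
  refine div_le_of_le_mul₀ (sq_nonneg _) hq ((abs_inner_walkOp_le f).trans ?_)
  simpa only [norm_l2Abs] using h (l2Abs f)

lemma HasSpectralGap.norm_walkOp_lt_one (h : HasSpectralGap G X) (hk : 0 < k)
    (ha : Generates a) : ‖walkOp X a‖ < 1 := by
  obtain ⟨F, ε, hε, hgap⟩ := h
  obtain ⟨C, hC, hdisp⟩ := exists_norm_permRep_sub_le ha X F
  set δ : ℝ := ε ^ 2 / (2 * C ^ 2 * (2 * k) ^ 2) with hδ
  have hform (f : ℓ²(X, ℝ)) : ⟪walkOp X a f, f⟫ ≤ (1 - δ) * ‖f‖ ^ 2 := by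
    obtain ⟨g, hg, hgf⟩ := hgap f
    have hsq : (ε * ‖f‖) ^ 2 ≤
        2 * C ^ 2 * (2 * k) ^ 2 * (‖f‖ ^ 2 - ⟪walkOp X a f, f⟫) := by
      calc (ε * ‖f‖) ^ 2 ≤ (C * ∑ x, ‖permRep X (letterVal a x) f - f‖) ^ 2 :=
            pow_le_pow_left₀ (by positivity) (hgf.trans (hdisp g hg f)) 2
        _ ≤ C ^ 2 * (2 * k * ∑ x, ‖permRep X (letterVal a x) f - f‖ ^ 2) := by
            rw [mul_pow, ← card_letters, ← Finset.card_univ]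
            gcongr
            exact sq_sum_le_card_mul_sum_sq
        _ = _ := by
            rw [sum_norm_permRep_letterVal_sub_sq]
            ring
    have hδf : δ * ‖f‖ ^ 2 ≤ ‖f‖ ^ 2 - ⟪walkOp X a f, f⟫ := by
      rw [hδ, div_mul_eq_mul_div, div_le_iff₀ (by positivity), ← mul_pow, mul_comm (_ - _)]
      exact hsq
    linarith
  refine (norm_walkOp_le_of_inner_le (le_max_right (1 - δ) 0) fun f => (hform f).trans ?_).trans_lt
    (max_lt (sub_lt_self 1 (by positivity)) one_pos)
  gcongr
  exact le_max_left _ _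

lemma HasSpectralGap.of_embeddings {G' Y I : Type*} [Group G'] [MulAction G' Y] [Finite I]
    [Nonempty I] (h : HasSpectralGap G' Y) {ι : I → Y ↪ X} (hι : ∀ x, ∃ i y, ι i y = x)
    {γ : I → G' → G} (hγ : ∀ i g y, ι i (g • y) = γ i g • ι i y) : HasSpectralGap G X := by
  classical
  have := Fintype.ofFinite I
  obtain ⟨F, ε, hε, hgap⟩ := h
  refine ⟨Finset.image₂ γ Finset.univ F, ε / √(Fintype.card I), by positivity, fun f => ?_⟩
  have hsum : ∑ _i : I, ‖f‖ ^ 2 / Fintype.card I ≤ ∑ i, ‖l2Restrict (ι i) f‖ ^ 2 := by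
    rw [Finset.sum_const, Finset.card_univ, nsmul_eq_mul, mul_div_cancel₀ _ (by positivity)]
    exact norm_sq_le_sum_norm_sq_l2Restrict ι hι f
  obtain ⟨i, -, hi⟩ := Finset.exists_le_of_sum_le Finset.univ_nonempty hsum
  obtain ⟨g, hg, hgf⟩ := hgap (l2Restrict (ι i) f)
  refine ⟨γ i g, Finset.mem_image₂_of_mem (Finset.mem_univ i) hg, ?_⟩
  have hcomm : permRep Y g (l2Restrict (ι i) f) = l2Restrict (ι i) (permRep X (γ i g) f) := by
    ext y
    have hy : ι i (g⁻¹ • y) = (γ i g)⁻¹ • ι i y := by rw [eq_inv_smul_iff, ← hγ, smul_inv_smul]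
    simp only [permRep_apply, l2Restrict_apply, hy]
  calc ε / √(Fintype.card I) * ‖f‖ = ε * √(‖f‖ ^ 2 / Fintype.card I) := by
        rw [Real.sqrt_div (sq_nonneg _), Real.sqrt_sq (norm_nonneg f)]
        ring
    _ ≤ ε * ‖l2Restrict (ι i) f‖ := by
        gcongr
        exact Real.sqrt_le_iff.2 ⟨norm_nonneg _, hi⟩
    _ ≤ ‖l2Restrict (ι i) (permRep X (γ i g) f - f)‖ := by rwa [map_sub, ← hcomm]
    _ ≤ ‖permRep X (γ i g) f - f‖ := norm_l2Restrict_apply_le _ _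

end SpectralGap

section GenericComplement

variable {G X I : Type*} [Group G] [MulAction G X] {k : ℕ} {a : Fin k → G}
  {S : Set (List (Fin k × Bool))} {u v : I → X}

lemma wordCount_compl_le_sum [Fintype I] (hS : Sᶜ ⊆ ⋃ i, {w | wordVal a w • u i = v i}) (n : ℕ) :
    (wordCount Sᶜ n : ℝ) ≤ ∑ i, (wordCount {w | wordVal a w • u i = v i} n : ℝ) := by
  exact_mod_cast (wordCount_mono hS n).trans (wordCount_iUnion_le _ n)

lemma generic_of_compl_subset [Finite I] [Infinite X] [MulAction.IsPretransitive G X] (hk : 0 < k)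
    (ha : Generates a) (hS : Sᶜ ⊆ ⋃ i, {w | wordVal a w • u i = v i}) : Generic S := by
  have := Fintype.ofFinite I
  have : Nonempty (Fin k × Bool) := ⟨⟨0, hk⟩, true⟩
  refine generic_of_tendsto ?_
  rw [card_letters]
  have hlim := tendsto_finsetSum Finset.univ fun i _ =>
    tendsto_wordCount_div_pow ha (u i) (v i)
  rw [Finset.sum_const_zero] at hlim
  refine squeeze_zero (fun n => by positivity) (fun n => ?_) hlim
  rw [← Finset.sum_div]
  gcongr
  exact wordCount_compl_le_sum hS n

lemma stronglyGeneric_of_compl_subset [Finite I] (hk : 0 < k) (h : ‖walkOp X a‖ < 1)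
    (hS : Sᶜ ⊆ ⋃ i, {w | wordVal a w • u i = v i}) : StronglyGeneric S := by
  have := Fintype.ofFinite I
  refine stronglyGeneric_of_le (by simp; lia) (norm_nonneg _) h (C := Fintype.card I) fun n => ?_
  rw [card_letters]
  calc (wordCount Sᶜ n : ℝ) ≤ ∑ i, (wordCount {w | wordVal a w • u i = v i} n : ℝ) :=
        wordCount_compl_le_sum hS n
    _ ≤ ∑ _i : I, (‖walkOp X a‖ * (2 * k)) ^ n :=
        Finset.sum_le_sum fun i _ => wordCount_le_norm_walkOp_pow hk (u i) (v i) n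
    _ = Fintype.card I * (‖walkOp X a‖ * (2 * k)) ^ n := by
        rw [Finset.sum_const, Finset.card_univ, nsmul_eq_mul]

end GenericComplement

section Preimage

variable {G Gbar : Type*} [Group G] [Group Gbar] {G₁ : Subgroup G} {φ : G₁ →* Gbar}
  {K : Subgroup Gbar}

variable (φ K) in
/-- The preimage of `K` under a homomorphism that is only defined on the subgroup `G₁` of `G`,
as a subgroup of `G`. -/
def preimage : Subgroup G := (K.comap φ).map G₁.subtype

lemma coe_mem_preimage {g : G₁} : (g : G) ∈ preimage φ K ↔ φ g ∈ K := by
  simp [preimage]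

lemma infinite_quotient_of_index_eq_zero {H : Subgroup G} (hH : H.index = 0) :
    Infinite (G ⧸ H) :=
  (Nat.card_eq_zero.1 hH).resolve_left (not_isEmpty_of_nonempty _)

lemma index_preimage_eq_zero (hφ : Function.Surjective φ) (hK : K.index = 0) :
    (preimage φ K).index = 0 := by
  rw [preimage, Subgroup.index_map_subtype, Subgroup.index_comap_of_surjective K hφ, hK, zero_mul]

lemma mk_mul_coe_eq_iff {x : G} {g g' : G₁} :
    ((x * g : G) : G ⧸ preimage φ K) = (x * g' : G) ↔ (φ g : Gbar ⧸ K) = φ g' := by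
  rw [QuotientGroup.eq, QuotientGroup.eq, ← map_inv, ← map_mul, ← coe_mem_preimage]
  simp [mul_assoc]

lemma HasSpectralGap.preimage [G₁.FiniteIndex] (hφ : Function.Surjective φ)
    (h : HasSpectralGap Gbar (Gbar ⧸ K)) : HasSpectralGap G (G ⧸ preimage φ K) := by
  set ψ : Gbar → G₁ := Function.surjInv hφ
  have hψ : ∀ x, φ (ψ x) = x := Function.surjInv_eq hφ
  -- The cosets of the preimage inside a fixed coset of `G₁` are a copy of `Gbar ⧸ K`.
  let ι (s : G ⧸ G₁) : Gbar ⧸ K ↪ G ⧸ GenericCase.preimage φ K :=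
    ⟨fun y => ((s.out * ψ y.out : G) : G ⧸ GenericCase.preimage φ K), fun y y' hy => by
      simpa [hψ] using mk_mul_coe_eq_iff.1 hy⟩
  refine h.of_embeddings (ι := ι) (fun x => ?_)
    (γ := fun s g => s.out * ψ g * s.out⁻¹) fun s g y => ?_
  · obtain ⟨g, rfl⟩ := QuotientGroup.mk_surjective x
    have hg : (g : G ⧸ G₁).out⁻¹ * g ∈ G₁ := QuotientGroup.eq.1 (QuotientGroup.out_eq' _)
    refine ⟨g, φ ⟨_, hg⟩, (mk_mul_coe_eq_iff (g' := ⟨_, hg⟩).2 ?_).trans (by simp)⟩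
    rw [hψ, QuotientGroup.out_eq']
  · have hmk : (φ (ψ (g • y).out) : Gbar ⧸ K) = φ (ψ g * ψ y.out) := by
      rw [map_mul, hψ, hψ, hψ, QuotientGroup.out_eq', ← smul_eq_mul, ← MulAction.Quotient.smul_coe,
        QuotientGroup.out_eq']
    refine (mk_mul_coe_eq_iff.2 hmk).trans (congrArg QuotientGroup.mk ?_)
    simp [mul_assoc]

end Preimage

section SchreierRewriting

variable {G Gbar : Type*} [Group G] [Group Gbar] {G₁ : Subgroup G} {r : G ⧸ G₁ → G}

lemma exists_transversal (G₁ H : Subgroup G) :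
    ∃ r : G ⧸ G₁ → G, (∀ s, (r s : G ⧸ G₁) = s) ∧ ∀ h ∈ H, r (h : G ⧸ G₁) ∈ H := by
  have hex (s : G ⧸ G₁) : ∃ g : G, (g : G ⧸ G₁) = s ∧ ∀ h ∈ H, (h : G ⧸ G₁) = s → g ∈ H := by
    by_cases hs : ∃ h ∈ H, (h : G ⧸ G₁) = s
    · obtain ⟨h, hh, rfl⟩ := hs
      exact ⟨h, rfl, fun _ _ _ => hh⟩
    · obtain ⟨g, rfl⟩ := QuotientGroup.mk_surjective s
      exact ⟨g, rfl, fun h hh hs' => absurd ⟨h, hh, hs'⟩ hs⟩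
  choose r hr hrH using hex
  exact ⟨r, hr, fun h hh => hrH _ h hh rfl⟩

/-- The Schreier cocycle of a transversal `r` of the subgroup `G₁`: the element of `G₁` to which
`g` is rewritten when rewriting starts at the coset `s`. -/
def cocycle (hr : ∀ s, (r s : G ⧸ G₁) = s) (s : G ⧸ G₁) (g : G) : G₁ :=
  ⟨(r s)⁻¹ * g * r (g⁻¹ • s), by
    rw [mul_assoc, ← QuotientGroup.eq, hr, ← smul_eq_mul, ← MulAction.Quotient.smul_coe, hr,
      smul_inv_smul]⟩

variable (hr : ∀ s, (r s : G ⧸ G₁) = s)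

lemma coe_cocycle (s : G ⧸ G₁) (g : G) :
    (cocycle hr s g : G) = (r s)⁻¹ * g * r (g⁻¹ • s) := rfl

lemma cocycle_one (s : G ⧸ G₁) : cocycle hr s 1 = 1 := by
  ext
  simp [coe_cocycle]

lemma cocycle_mul (s : G ⧸ G₁) (g h : G) :
    cocycle hr s (g * h) = cocycle hr s g * cocycle hr (g⁻¹ • s) h := by
  ext
  simp [coe_cocycle, mul_assoc, mul_smul]

lemma exists_cocycle_eq (s : G ⧸ G₁) (g : G₁) : ∃ x, cocycle hr s x = g := by
  have hs : (r s * g * (r s)⁻¹)⁻¹ • s = s := by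
    calc (r s * g * (r s)⁻¹)⁻¹ • s = (((r s * g * (r s)⁻¹)⁻¹ * r s : G) : G ⧸ G₁) := by
          rw [← smul_eq_mul _ (r s), ← MulAction.Quotient.smul_coe, hr]
      _ = r s := by simp [mul_assoc]
      _ = s := hr s
  refine ⟨r s * g * (r s)⁻¹, Subtype.ext ?_⟩
  rw [coe_cocycle, hs]
  group

lemma cocycle_mem {H : Subgroup G} (hrH : ∀ h ∈ H, r (h : G ⧸ G₁) ∈ H) {g : G} (hg : g ∈ H) :
    (cocycle hr ((1 : G) : G ⧸ G₁) g : G) ∈ H := by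
  rw [coe_cocycle, MulAction.Quotient.smul_coe, smul_eq_mul, mul_one]
  exact mul_mem (mul_mem (inv_mem (hrH 1 (one_mem H))) hg) (hrH _ (inv_mem hg))

lemma cocycle_mem_preimage_iff (φ : G₁ →* Gbar) (K : Subgroup Gbar) (s : G ⧸ G₁) (g : G) :
    φ (cocycle hr s g) ∈ K ↔
      g • (r (g⁻¹ • s) : G ⧸ preimage φ K) = r s := by
  rw [← coe_mem_preimage, coe_cocycle, MulAction.Quotient.smul_coe, smul_eq_mul, eq_comm,
    QuotientGroup.eq, mul_assoc]

variable [G₁.FiniteIndex] {k : ℕ} (a : Fin k → G)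

/-- The images in `Gbar` of the Schreier generators of `G₁`, one for each coset and each letter. -/
noncomputable def schreierGenerators (φ : G₁ →* Gbar) :
    Fin (Nat.card ((G ⧸ G₁) × Fin k × Bool)) → Gbar :=
  fun i => φ (cocycle hr ((Finite.equivFin _).symm i).1
    (letterVal a ((Finite.equivFin ((G ⧸ G₁) × Fin k × Bool)).symm i).2))

variable (G₁) in
/-- Schreier rewriting as a transducer; its states are the cosets of `G₁`, numbered because states
live in `Type`. -/
noncomputable def schreierTransducer :
    Transducer (Fin k × Bool) (Fin (Nat.card ((G ⧸ G₁) × Fin k × Bool)) × Bool) where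
  S := Fin (Nat.card (G ⧸ G₁))
  finiteS := inferInstance
  start := Finite.equivFin _ ((1 : G) : G ⧸ G₁)
  step := fun x => (Finite.equivFin (G ⧸ G₁)).permCongr (MulAction.toPerm (letterVal a x)⁻¹)
  out := fun s x => (Finite.equivFin _ ((Finite.equivFin (G ⧸ G₁)).symm s, x), true)

variable (G₁) in
/-- The numbering of the cosets of `G₁` by the states of the Schreier transducer. -/
noncomputable def schreierState : G ⧸ G₁ ≃ (schreierTransducer G₁ a).S :=
  Finite.equivFin (G ⧸ G₁)

lemma step_schreierState (s : G ⧸ G₁) (x : Fin k × Bool) :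
    (schreierTransducer G₁ a).step x (schreierState G₁ a s) =
      schreierState G₁ a ((letterVal a x)⁻¹ • s) :=
  congrArg (fun t => Finite.equivFin (G ⧸ G₁) ((letterVal a x)⁻¹ • t)) (Equiv.symm_apply_apply _ s)

lemma letterVal_out_schreierState (φ : G₁ →* Gbar) (s : G ⧸ G₁) (x : Fin k × Bool) :
    letterVal (schreierGenerators hr a φ)
        ((schreierTransducer G₁ a).out (schreierState G₁ a s) x) =
      φ (cocycle hr s (letterVal a x)) := by
  have hs : (Finite.equivFin (G ⧸ G₁)).symm (schreierState G₁ a s) = s :=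
    Equiv.symm_apply_apply _ s
  calc _ = φ (cocycle hr ((Finite.equivFin (G ⧸ G₁)).symm (schreierState G₁ a s))
          (letterVal a x)) := by simp [schreierTransducer, schreierGenerators, letterVal]
    _ = φ (cocycle hr s (letterVal a x)) := congrArg (fun t => φ (cocycle hr t _)) hs

lemma wordVal_output_schreierState (φ : G₁ →* Gbar) (s : G ⧸ G₁) (w : List (Fin k × Bool)) :
    wordVal (schreierGenerators hr a φ)
        ((schreierTransducer G₁ a).output (schreierState G₁ a s) w) =
      φ (cocycle hr s (wordVal a w)) := by
  induction w generalizing s with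
  | nil => rw [wordVal_nil, cocycle_one, map_one, Transducer.output, wordVal_nil]
  | cons x w ih =>
    rw [Transducer.output, wordVal_cons, letterVal_out_schreierState, step_schreierState, ih,
      wordVal_cons, cocycle_mul, map_mul]

variable {a}

lemma generates_schreierGenerators {φ : G₁ →* Gbar} (hφ : Function.Surjective φ)
    (ha : Generates a) : Generates (schreierGenerators hr a φ) := by
  refine eq_top_iff.2 fun y _ => ?_
  obtain ⟨g, rfl⟩ := hφ y
  obtain ⟨x, rfl⟩ := exists_cocycle_eq hr ((1 : G) : G ⧸ G₁) g
  obtain ⟨w, rfl⟩ := ha.exists_wordVal_eq x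
  rw [← wordVal_output_schreierState]
  exact wordVal_mem_closure _

lemma exists_partial_algorithm {H : Subgroup G} {φ : G₁ →* Gbar} (hφ : Function.Surjective φ)
    {K : Subgroup Gbar} (hHK : (H.subgroupOf G₁).map φ ≤ K) {C : ComplexityClass}
    (hC : MembershipIn C K) (ha : Generates a) :
    ∃ (M : Machine (Fin k × Bool)) (S : Set (List (Fin k × Bool)))
      (u v : G ⧸ G₁ → G ⧸ preimage φ K), C.AllowsMode M ∧ CorrectFor M (MP H a) ∧
      C.DecidesOn M S ∧ Sᶜ ⊆ ⋃ s, {w | wordVal a w • u s = v s} := by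
  obtain ⟨r, hr, hrH⟩ := exists_transversal G₁ H
  have houtput (w : List (Fin k × Bool)) :=
    wordVal_output_schreierState hr a φ ((1 : G) : G ⧸ G₁) w
  obtain ⟨M, hmode, hcorrect, hdecides⟩ := (hC _ _ (generates_schreierGenerators hr hφ ha)
    ).exists_pullback (schreierTransducer G₁ a) (E := MP H a) fun w hw =>
      (houtput w ▸ hHK ⟨_, cocycle_mem hr hrH hw, rfl⟩ : wordVal _ _ ∈ K)
  refine ⟨M, _, fun s => (r s : G), fun _ => (r ((1 : G) : G ⧸ G₁) : G), hmode, hcorrect,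
    hdecides, fun w hw => Set.mem_iUnion.2 ⟨(wordVal a w)⁻¹ • ((1 : G) : G ⧸ G₁), ?_⟩⟩
  refine (cocycle_mem_preimage_iff hr φ K _ _).1 ?_
  exact houtput w ▸ not_not.1 hw

end SchreierRewriting

end GenericCase

open GenericCase in
theorem theoremB_general {G Gbar : Type*} [Group G] [Group Gbar] (G₁ H : Subgroup G)
    [G₁.FiniteIndex] (φ : G₁ →* Gbar) (hφ : Function.Surjective φ) (K : Subgroup Gbar)
    (hHK : (H.subgroupOf G₁).map φ ≤ K) (hK : K.index = 0) (C : ComplexityClass)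
    (hC : MembershipIn C K) :
    MembershipGenericallyIn C H ∧
      ((∃ (k : ℕ) (b : Fin k → Gbar), Generates b ∧ ¬ SchreierAmenable K b) →
        (∀ (k : ℕ) (b : Fin k → Gbar), Generates b → ¬ SchreierAmenable K b) ∧
          MembershipStronglyGenericallyIn C H) := by
  have := infinite_quotient_of_index_eq_zero hK
  have := infinite_quotient_of_index_eq_zero (index_preimage_eq_zero hφ hK)
  have : Infinite Gbar := .of_surjective _ (QuotientGroup.mk_surjective (s := K))
  have : Infinite G := .of_surjective _ (QuotientGroup.mk_surjective (s := preimage φ K))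
  refine ⟨fun k a ha => ?_, ?_⟩
  · obtain ⟨M, S, u, v, hmode, hcorrect, hdecides, hS⟩ := exists_partial_algorithm hφ hHK hC ha
    exact ⟨M, hmode, hcorrect, S, generic_of_compl_subset ha.pos_of_nontrivial ha hS, hdecides⟩
  · rintro ⟨m, b, hb, hna⟩
    have hgap : HasSpectralGap Gbar (Gbar ⧸ K) :=
      hasSpectralGap_of_norm_walkOp_lt_one hb.pos_of_nontrivial <|
        (not_schreierAmenable_iff_norm_walkOp_lt_one hb.pos_of_nontrivial hb).1 hna
    refine ⟨fun k c hc => (not_schreierAmenable_iff_norm_walkOp_lt_one hc.pos_of_nontrivial hc).2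
      (hgap.norm_walkOp_lt_one hc.pos_of_nontrivial hc), fun k a ha => ?_⟩
    obtain ⟨M, S, u, v, hmode, hcorrect, hdecides, hS⟩ := exists_partial_algorithm hφ hHK hC ha
    have hnorm := (hgap.preimage hφ).norm_walkOp_lt_one ha.pos_of_nontrivial ha
    exact ⟨M, hmode, hcorrect, S,
      stronglyGeneric_of_compl_subset ha.pos_of_nontrivial hnorm hS, hdecides⟩

open GenericCase in
theorem theoremB {G Gbar : Type*} [Group G] [Group Gbar] [Group.FG G]
    (G₁ H : Subgroup G) [G₁.FiniteIndex] (hH : H ≤ G₁)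
    (φ : G₁ →* Gbar) (hφ : Function.Surjective φ)
    (K : Subgroup Gbar) (hHK : (H.subgroupOf G₁).map φ ≤ K) (hK : K.index = 0)
    (C : ComplexityClass) (hC : MembershipIn C K) :
    MembershipGenericallyIn C H ∧
      ((∃ (k : ℕ) (b : Fin k → Gbar), Generates b ∧ ¬ SchreierAmenable K b) →
        (∀ (k : ℕ) (b : Fin k → Gbar), Generates b → ¬ SchreierAmenable K b) ∧
          MembershipStronglyGenericallyIn C H) :=
  theoremB_general G₁ H φ hφ K hHK hK C hC
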